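/- Let $2k\in\{2,3,\dots\}$, $k'=k-\tfrac14$. On the Hilbert space with orthonormal basis $\varphi_n\otimes e_{k',k'+m}$ ($n,m\ge 0$), let $a,a^\dagger$ be the boson operators on the $\varphi_n$, let $K'_0,K'_\pm$ be the $\mathrm{su}(1,1)$ generators of the lowest-weight-$k'$ representation on the $e_{k',k'+m}$, and let $$K_+=\tfrac12(a^\dagger)^2+K'_+,\quad K_-=\tfrac12a^2+K'_-,\quad K_0=\tfrac12(a^\dagger a+\tfrac12)+K'_0$$ be the resulting generators of the Jacobi algebra, with lowest weight vector $e_0=\varphi_0\otimes e_{k',k'}$. Let $e_{z,w}=\exp(za^\dagger+wK_+)e_0$ for $(z,w)\in\mathcal D^J_1=\{z\in\mathbb C,\ |w|<1\}$, and let $\mathcal X^J_1=\{(v,u)\in\mathbb C^2:\operatorname{Im}v>0\}$. Scalar products are antilinear in the first argument. Let $\epsilon_a,\epsilon_0,\epsilon_\pm$ be continuous complex functions of time $t$ on an open interval $J$ (for example constants) with $\bar\epsilon_+=\epsilon_-$ and $\bar\epsilon_0=\epsilon_0$, and consider the hermitian linear Hamiltonians $$H=\epsilon_a a+\bar\epsilon_a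 a^\dagger+\epsilon_0K_0+\epsilon_+K_++\epsilon_-K_-,\qquad \tilde H=\bar\epsilon_a a+\epsilon_a a^\dagger+\epsilon_0K_0+\epsilon_-K_++\epsilon_+K_- .$$ Put $(z_1,z_2)=(z,w)$, let $g_{\alpha\beta}=\partial_{z_\alpha}\partial_{\bar z_\beta}\log\langle e_{z,w},e_{z,w}\rangle$, and let $$\{f,h\}=\sum_{\alpha,\beta}(g^{-1})_{\beta\alpha}\bigl(\partial_{z_\alpha}f\,\partial_{\bar z_\beta}h-\partial_{\bar z_\beta}f\,\partial_{z_\alpha}h\bigr).$$ (0) For $|w|<1$ the vector $e_{z,w}$, and its image under every linear combination of $a,a^\dagger,K_0,K_\pm$, lie in the Hilbert space. (1) For every curve $(z(t),w(t))$, $t\in J$, in $\mathcal D^J_1$ the following are equivalent. (a) Classical motion for $\tilde H$: $\dot z=i\{\mathcal H,z\}$ and $\dot w=i\{\mathcal H,w\}$ on $J$, with $\mathcal H(z,w)=\langle e_{z,w},\tilde He_{z,w}\rangle/\langle e_{z,w},e_{z,w}\rangle$. (b) Quantum motion for $\tilde H$: for some differentiable real phase $\varphi(t)$ the vector $\psi=e^{i\varphi}\langle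 e_{z,w},e_{z,w}\rangle^{-1/2}e_{z,w}$ satisfies $i\dot\psi=\tilde H\psi$ on $J$ (derivative in norm). (c) Classical motion for $H$ in the holomorphic realization, in which a vector $\psi$ is the function $(z,w)\mapsto\langle e_{\bar z,\bar w},\psi\rangle$: $\dot z=i\{\mathcal H,z\}$ and $\dot w=i\{\mathcal H,w\}$ on $J$, with $\mathcal H(z,w)=\langle e_{\bar z,\bar w},He_{\bar z,\bar w}\rangle/\langle e_{\bar z,\bar w},e_{\bar z,\bar w}\rangle$. (d) The equations of motion $$i\dot z=\epsilon_a+\bar\epsilon_aw+\bigl(\tfrac{\epsilon_0}{2}+\epsilon_+w\bigr)z,\qquad i\dot w=\epsilon_-+\epsilon_0w+\epsilon_+w^2 .$$ (2) For a curve $(v(t),u(t))$ in $\mathcal X^J_1$, the curve given by the partial Cayley transform $w=\frac{v-i}{v+i}$, $z=\frac{2iu}{v+i}$ satisfies (d) on $J$ if and only if $$-2\dot v=(\epsilon_0+\epsilon_++\epsilon_-)v^2+2i(\epsilon_--\epsilon_+)v+\epsilon_0-\epsilon_--\epsilon_+,$$ $$-2\dot u=(\epsilon_a+\bar\epsilon_a)v+i(\epsilon_a-\bar\epsilon_a)+[(\epsilon_0+\epsilon_++\epsilon_-)v+i(\epsilon_--\epsilon_+)]u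 .$$ (3) For a curve $(z,w)$ in $\mathcal D^J_1$ put $\eta=\frac{z+w\bar z}{1-|w|^2}$. Then (d) holds if and only if $(\eta,w)$ satisfies the decoupled system $$i\dot\eta=\epsilon_a+\epsilon_-\bar\eta+\tfrac{\epsilon_0}{2}\eta,\qquad i\dot w=\epsilon_-+\epsilon_0w+\epsilon_+w^2 .$$ (4) For a curve $(v,u)$ in $\mathcal X^J_1$ put $\eta=\frac{u\bar v-\bar uv+i(\bar u-u)}{\bar v-v}$. Then the system in (2) holds if and only if $$i\dot\eta=\epsilon_a+\epsilon_-\bar\eta+\tfrac{\epsilon_0}{2}\eta,\qquad -2\dot v=(\epsilon_0+\epsilon_++\epsilon_-)v^2+2i(\epsilon_--\epsilon_+)v+\epsilon_0-\epsilon_--\epsilon_+ .$$ -/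

import Mathlib

open Complex ComplexConjugate

namespace SiegelJacobi

noncomputable section

/-! ## The Hilbert space and the generators of the Jacobi algebra

The Hilbert space is the tensor product of the boson Fock space, with orthonormal basis
`φ_n = (n!)^(-1/2) (a†)^n φ_0`, and of the discrete series space of `su(1,1)` of lowest weight
`k' = k - 1/4`, with orthonormal basis `e_{k',k'+m}`.  A vector is given by its coefficients in
the orthonormal basis `φ_n ⊗ e_{k',k'+m}`, so the Hilbert space is `ℓ²(ℕ × ℕ)`. -/

/-- All coefficient families.  The generators are finite band matrices, so they act on all of
them; a vector of `ℓ²` is in the (maximal) domain of an operator if its image is in `ℓ²`. -/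
abbrev Coeff : Type := ℕ × ℕ → ℂ

/-- The Hilbert space of the representation. -/
abbrev Hilb : Type := lp (fun _ : ℕ × ℕ => ℂ) 2

/-- The annihilation operator, `a φ_n = √n φ_{n-1}`. -/
def opA : Module.End ℂ Coeff where
  toFun f q := (Real.sqrt (q.1 + 1) : ℂ) * f (q.1 + 1, q.2)
  map_add' f g := by ext q; simp [mul_add]
  map_smul' c f := by ext q; simp [mul_left_comm]

/-- The creation operator, `a† φ_n = √(n+1) φ_{n+1}` (the factor `√0` removes the term with
the truncated index). -/
def opAd : Module.End ℂ Coeff where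
  toFun f q := (Real.sqrt q.1 : ℂ) * f (q.1 - 1, q.2)
  map_add' f g := by ext q; simp [mul_add]
  map_smul' c f := by ext q; simp [mul_left_comm]

/-- `K'_0 e_{k',k'+m} = (k' + m) e_{k',k'+m}`. -/
def opK0' (k' : ℝ) : Module.End ℂ Coeff where
  toFun f q := ((k' + q.2 : ℝ) : ℂ) * f q
  map_add' f g := by ext q; simp [mul_add]
  map_smul' c f := by ext q; simp [mul_left_comm]

/-- `K'_+ e_{k',k'+m} = √((m+1)(m+2k')) e_{k',k'+m+1}` (the factor `√0` removes the term with
the truncated index). -/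
def opKp' (k' : ℝ) : Module.End ℂ Coeff where
  toFun f q := (Real.sqrt (q.2 * (q.2 - 1 + 2 * k')) : ℂ) * f (q.1, q.2 - 1)
  map_add' f g := by ext q; simp [mul_add]
  map_smul' c f := by ext q; simp [mul_left_comm]

/-- `K'_- e_{k',k'+m} = √(m(m-1+2k')) e_{k',k'+m-1}`. -/
def opKm' (k' : ℝ) : Module.End ℂ Coeff where
  toFun f q := (Real.sqrt ((q.2 + 1) * (q.2 + 2 * k')) : ℂ) * f (q.1, q.2 + 1)
  map_add' f g := by ext q; simp [mul_add]
  map_smul' c f := by ext q; simp [mul_left_comm]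

/-- `K_0 = (a†a + 1/2)/2 + K'_0`, with `k' = k - 1/4`. -/
def opK0 (k : ℝ) : Module.End ℂ Coeff :=
  (1 / 2 : ℂ) • (opAd * opA + (1 / 2 : ℂ) • 1) + opK0' (k - 1 / 4)

/-- `K_+ = (a†)²/2 + K'_+`. -/
def opKp (k : ℝ) : Module.End ℂ Coeff := (1 / 2 : ℂ) • opAd ^ 2 + opKp' (k - 1 / 4)

/-- `K_- = a²/2 + K'_-`. -/
def opKm (k : ℝ) : Module.End ℂ Coeff := (1 / 2 : ℂ) • opA ^ 2 + opKm' (k - 1 / 4)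

/-- The operator `ca a + cd a† + c0 K_0 + cp K_+ + cm K_-`, linear in the generators. -/
def linHam (k : ℝ) (ca cd c0 cp cm : ℂ) : Module.End ℂ Coeff :=
  ca • opA + cd • opAd + c0 • opK0 k + cp • opKp k + cm • opKm k

/-- The lowest weight vector `e_0 = φ_0 ⊗ e_{k',k'}`. -/
def vac : Coeff := Pi.single (0, 0) 1

/-- Perelomov's coherent state vector `e_{z,w} = exp(z a† + w K_+) e_0` (exponential series;
each coefficient is a finite sum). -/
def coh (k : ℝ) (z w : ℂ) : Coeff :=
  ∑' N : ℕ, ((N.factorial : ℂ)⁻¹) • ((z • opAd + w • opKp k) ^ N) vac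

/-- The scalar product `⟨x, y⟩`, antilinear in `x`. -/
def braket (x y : Coeff) : ℂ := ∑' q, conj (x q) * y q

/-- The covariant symbol `⟨x|H|x⟩ / ⟨x,x⟩`. -/
def symb (H : Module.End ℂ Coeff) (x : Coeff) : ℂ := braket x (H x) / braket x x

/-! ## Kähler structure and Poisson bracket on the Siegel-Jacobi disk

Points are `p : Fin 2 → ℂ` with `p 0 = z`, `p 1 = w`. -/

/-- The Wirtinger derivative `∂f/∂z_α`. -/
def dHol (α : Fin 2) (f : (Fin 2 → ℂ) → ℂ) (p : Fin 2 → ℂ) : ℂ :=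
  (fderiv ℝ f p (Pi.single α 1) - I * fderiv ℝ f p (Pi.single α I)) / 2

/-- The Wirtinger derivative `∂f/∂z̄_α`. -/
def dAnti (α : Fin 2) (f : (Fin 2 → ℂ) → ℂ) (p : Fin 2 → ℂ) : ℂ :=
  (fderiv ℝ f p (Pi.single α 1) + I * fderiv ℝ f p (Pi.single α I)) / 2

/-- The Kähler potential `log ⟨e_{z,w}, e_{z,w}⟩`. -/
def kahlerPot (k : ℝ) (p : Fin 2 → ℂ) : ℂ :=
  (Real.log (braket (coh k (p 0) (p 1)) (coh k (p 0) (p 1))).re : ℂ)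

/-- `g_{αβ} = ∂²/∂z_α∂z̄_β log ⟨e_{z,w}, e_{z,w}⟩`. -/
def metric (k : ℝ) (p : Fin 2 → ℂ) : Matrix (Fin 2) (Fin 2) ℂ :=
  Matrix.of fun α β => dHol α (dAnti β (kahlerPot k)) p

/-- The Poisson bracket of the Kähler form `i ∑ g_{αβ} dz_α ∧ dz̄_β`:
`{f, h} = ∑ (g⁻¹)_{βα} (∂f/∂z_α ∂h/∂z̄_β - ∂f/∂z̄_β ∂h/∂z_α)`. -/
def poisson (k : ℝ) (f h : (Fin 2 → ℂ) → ℂ) (p : Fin 2 → ℂ) : ℂ :=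
  ∑ α, ∑ β, (metric k p)⁻¹ β α * (dHol α f p * dAnti β h p - dAnti β f p * dHol α h p)

/-- Berezin's classical equations of motion `ż_α = i {E, z_α}` on the time set `J`, for the
time-dependent energy function `E t`. -/
def ClassicalMotion (k : ℝ) (E : ℝ → (Fin 2 → ℂ) → ℂ) (J : Set ℝ) (z w : ℝ → ℂ) : Prop :=
  ∀ t ∈ J, DifferentiableAt ℝ z t ∧ DifferentiableAt ℝ w t ∧
    deriv z t = I * poisson k (E t) (fun p => p 0) ![z t, w t] ∧
    deriv w t = I * poisson k (E t) (fun p => p 1) ![z t, w t]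

/-- Quantum motion: for a suitable real phase `φ`, the curve
`ψ = e^{iφ} ⟨e_{z,w}, e_{z,w}⟩^{-1/2} e_{z,w}` in the Hilbert space is differentiable in norm
and satisfies the Schrödinger equation `i ψ̇ = H ψ` on `J`. -/
def QuantumMotion (k : ℝ) (H : ℝ → Module.End ℂ Coeff) (J : Set ℝ) (z w : ℝ → ℂ) : Prop :=
  ∃ (φ : ℝ → ℝ) (ψ : ℝ → Hilb), ∀ t ∈ J,
    DifferentiableAt ℝ φ t ∧
    (ψ t : Coeff) = (exp (I * φ t) /
      (Real.sqrt (braket (coh k (z t) (w t)) (coh k (z t) (w t))).re : ℂ)) • coh k (z t) (w t) ∧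
    DifferentiableAt ℝ ψ t ∧
    I • ((deriv ψ t : Hilb) : Coeff) = H t (ψ t : Coeff)

/-! ## The four systems of differential equations -/

/-- `i ż = ε_a + ε̄_a w + (ε_0/2 + ε_+ w) z`, `i ẇ = ε_- + ε_0 w + ε_+ w²`. -/
def DiskEq (εa ε0 εp εm : ℝ → ℂ) (J : Set ℝ) (z w : ℝ → ℂ) : Prop :=
  ∀ t ∈ J, DifferentiableAt ℝ z t ∧ DifferentiableAt ℝ w t ∧
    I * deriv z t = εa t + conj (εa t) * w t + (ε0 t / 2 + εp t * w t) * z t ∧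
    I * deriv w t = εm t + ε0 t * w t + εp t * w t ^ 2

/-- `-2 v̇ = (ε_0+ε_++ε_-) v² + 2i(ε_--ε_+) v + ε_0-ε_--ε_+`,
`-2 u̇ = (ε_a+ε̄_a) v + i(ε_a-ε̄_a) + [(ε_0+ε_++ε_-) v + i(ε_--ε_+)] u`. -/
def HalfPlaneEq (εa ε0 εp εm : ℝ → ℂ) (J : Set ℝ) (v u : ℝ → ℂ) : Prop :=
  ∀ t ∈ J, DifferentiableAt ℝ v t ∧ DifferentiableAt ℝ u t ∧
    -2 * deriv v t = (ε0 t + εp t + εm t) * v t ^ 2 + 2 * I * (εm t - εp t) * v t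
      + ε0 t - εm t - εp t ∧
    -2 * deriv u t = (εa t + conj (εa t)) * v t + I * (εa t - conj (εa t))
      + ((ε0 t + εp t + εm t) * v t + I * (εm t - εp t)) * u t

/-- `i η̇ = ε_a + ε_- η̄ + (ε_0/2) η`, `i ẇ = ε_- + ε_0 w + ε_+ w²`. -/
def DecoupledDiskEq (εa ε0 εp εm : ℝ → ℂ) (J : Set ℝ) (η w : ℝ → ℂ) : Prop :=
  ∀ t ∈ J, DifferentiableAt ℝ η t ∧ DifferentiableAt ℝ w t ∧
    I * deriv η t = εa t + εm t * conj (η t) + ε0 t / 2 * η t ∧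
    I * deriv w t = εm t + ε0 t * w t + εp t * w t ^ 2

/-- `i η̇ = ε_a + ε_- η̄ + (ε_0/2) η`,
`-2 v̇ = (ε_0+ε_++ε_-) v² + 2i(ε_--ε_+) v + ε_0-ε_--ε_+`. -/
def DecoupledHalfPlaneEq (εa ε0 εp εm : ℝ → ℂ) (J : Set ℝ) (η v : ℝ → ℂ) : Prop :=
  ∀ t ∈ J, DifferentiableAt ℝ η t ∧ DifferentiableAt ℝ v t ∧
    I * deriv η t = εa t + εm t * conj (η t) + ε0 t / 2 * η t ∧
    -2 * deriv v t = (ε0 t + εp t + εm t) * v t ^ 2 + 2 * I * (εm t - εp t) * v t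
      + ε0 t - εm t - εp t

/-! ## The changes of variables -/

/-- `w`-component of the partial Cayley transform. -/
def cayleyW (v : ℂ) : ℂ := (v - I) / (v + I)

/-- `z`-component of the partial Cayley transform. -/
def cayleyZ (v u : ℂ) : ℂ := 2 * I * u / (v + I)

/-- The variable `η = (z + w z̄)/(1 - |w|²)` on the Siegel-Jacobi disk, i.e. `z = η - w η̄`. -/
def etaDisk (z w : ℂ) : ℂ := (z + w * conj z) / (1 - (‖w‖ : ℂ) ^ 2)

/-- The variable `η = (u v̄ - ū v + i(ū - u))/(v̄ - v)` on the Siegel-Jacobi upper half plane,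
i.e. `2iu = (v + i) η - (v - i) η̄`. -/
def etaHalfPlane (v u : ℂ) : ℂ :=
  (u * conj v - conj u * v + I * (conj u - u)) / (conj v - v)

end

end SiegelJacobi

open SiegelJacobi

/-! The vectors `e_{z,w}` depend holomorphically on `(z, w)`, with `∂_z e = a† e` and `∂_w e = K_+
e`, and every generator acts on them as a first-order holomorphic differential operator. Hence a
linear Hamiltonian satisfies `H e = P e + A_z ∂_z e + A_w ∂_w e` with polynomials `P, A_z, A_w` in
`(z, w)` (`linHam_coh`). All versions of the motion say that `i(ż, ẇ) = (A_z, A_w)`.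

Classically, put `F = log ⟨e, e⟩`. The symbol of `H` is `P + A_z ∂_z F + A_w ∂_w F`; since `P` and
`A` are holomorphic, its antiholomorphic differential is the row `A g`. The bracket with a
coordinate applies `-g⁻¹` and returns `-A` (`poisson_symbForm`). No closed form of `⟨e, e⟩` is
needed: adjointness gives linear equations for `⟨e, a† e⟩` and `⟨e, K_+ e⟩`, whose solutions are the
first derivatives of `F` and so yield `g`. Complex conjugation of the point exchanges `a` with `a†`
and `K_+` with `K_-` in the symbol, which carries `H` to `H̃`.

In the quantum case, for `ψ = c e`, comparison of three coefficients of `iψ̇ = Hψ` gives the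
equations for `z` and `w`. Conversely these leave only `iċ = P c`: the modulus of `c` obeys it
because the symbol of a hermitian operator is real, and the phase is a primitive of `-Re P`
(`quantumMotion_iff`).

The analysis rests on geometric decay of the coefficients of `e_{z,w}` for `|w| < 1`, which survives
the generators and permits termwise differentiation in norm (`hasFDerivAt_cohHilb`).

The variable `η` is the expectation value of `a`, and `z = η - w η̄`. Given the Riccati equation,
the residuals of the two linear equations are related by `R_z = R_η + w conj R_η`, an injective map
when `|w| < 1`. The half plane statements follow by the Cayley transform, under which `η` is the
same function. -/

namespace SiegelJacobi

noncomputable section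

open Filter Topology

/-! ## Explicit coefficients of the coherent state vectors -/

/-- The two-variable Hermite polynomials, with `∑ P_n(z, w) tⁿ / n! = exp (z t + w t² / 2)`. -/
def hermiteTwo {R : Type*} [CommRing R] (z w : R) : ℕ → R
  | 0 => 1
  | 1 => z
  | n + 2 => z * hermiteTwo z w (n + 1) + (n + 1) * w * hermiteTwo z w n

/-- The square root of `Γ(2κ + m) / (m! Γ(2κ))`. -/
def suRadial (κ : ℝ) : ℕ → ℝ
  | 0 => 1
  | m + 1 => Real.sqrt ((m + 2 * κ) / (m + 1)) * suRadial κ m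

/-- The coefficients of `e_{z,w}`. -/
def cohCoeff (k : ℝ) (z w : ℂ) : Coeff := fun q =>
  hermiteTwo z w q.1 / (Real.sqrt (q.1.factorial) : ℂ) * (suRadial (k - 1 / 4) q.2 * w ^ q.2)

lemma hermiteTwo_succ {R : Type*} [CommRing R] (z w : R) (n : ℕ) :
    hermiteTwo z w (n + 1) = z * hermiteTwo z w n + n * w * hermiteTwo z w (n - 1) := by
  cases n with
  | zero => simp [hermiteTwo]
  | succ n => simp [hermiteTwo]

lemma mul_hermiteTwo {R : Type*} [CommRing R] (z w : R) (n : ℕ) :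
    (n : R) * hermiteTwo z w n
      = n * z * hermiteTwo z w (n - 1) + n * (n - 1) * w * hermiteTwo z w (n - 2) := by
  cases n with
  | zero => simp
  | succ n =>
    rw [hermiteTwo_succ]
    simp only [Nat.add_sub_cancel, show n + 1 - 2 = n - 1 from rfl]
    push_cast; ring

/-- The linear form `v ↦ a v₀ + b v₁`. -/
def formTwo (a b : ℂ) : (Fin 2 → ℂ) →L[ℂ] ℂ :=
  a • ContinuousLinearMap.proj 0 + b • ContinuousLinearMap.proj 1

@[simp] lemma formTwo_apply (a b : ℂ) (v : Fin 2 → ℂ) : formTwo a b v = a * v 0 + b * v 1 := by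
  simp [formTwo]

/-- On the generating function `exp (z t + w t² / 2)`, `∂_z` multiplies by `t` and `∂_w` by `t² /
2`. Wherever an index is truncated, its factor `n` or `n (n - 1)` is zero. -/
lemma hasFDerivAt_hermiteTwo (p : Fin 2 → ℂ) (n : ℕ) :
    HasFDerivAt (fun p : Fin 2 → ℂ => hermiteTwo (p 0) (p 1) n)
      (formTwo (n * hermiteTwo (p 0) (p 1) (n - 1))
        (n * (n - 1) / 2 * hermiteTwo (p 0) (p 1) (n - 2))) p := by
  have h0 : HasFDerivAt (fun p : Fin 2 → ℂ => p 0) (ContinuousLinearMap.proj 0 : _ →L[ℂ] ℂ) p :=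
    hasFDerivAt_apply 0 p
  have h1 : HasFDerivAt (fun p : Fin 2 → ℂ => p 1) (ContinuousLinearMap.proj 1 : _ →L[ℂ] ℂ) p :=
    hasFDerivAt_apply 1 p
  induction n using Nat.twoStepInduction with
  | zero =>
    simp only [hermiteTwo]
    refine (hasFDerivAt_const (1 : ℂ) p).congr_fderiv ?_
    ext v; simp
  | one =>
    simp only [hermiteTwo]
    refine h0.congr_fderiv ?_
    ext v; simp [hermiteTwo]
  | more n ih0 ih1 =>
    simp only [hermiteTwo]
    refine ((h0.mul ih1).add ((h1.const_mul ((n : ℂ) + 1)).mul ih0)).congr_fderiv ?_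
    have e1 := hermiteTwo_succ (p 0) (p 1) n
    have e2 := mul_hermiteTwo (p 0) (p 1) n
    refine ContinuousLinearMap.ext fun v => ?_
    simp only [formTwo_apply, add_apply, smul_apply,
      ContinuousLinearMap.proj_apply, smul_eq_mul, Nat.add_sub_cancel,
      show n + 2 - 1 = n + 1 from rfl, show n + 1 - 2 = n - 1 from rfl]
    push_cast
    linear_combination (- (n + 1) * v 0) * e1 - (n + 1) / 2 * v 1 * e2

lemma sqrt_factorial_succ (n : ℕ) :
    (Real.sqrt ((n + 1).factorial) : ℂ) = Real.sqrt (n + 1) * Real.sqrt (n.factorial) := by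
  rw [Nat.factorial_succ]; push_cast
  rw [Real.sqrt_mul (by positivity)]; push_cast; rfl

lemma sqrt_factorial_ne_zero (n : ℕ) : (Real.sqrt (n.factorial) : ℂ) ≠ 0 := by
  have : (0 : ℝ) < n.factorial := by positivity
  exact_mod_cast (Real.sqrt_pos.2 this).ne'

lemma ofReal_sqrt_mul_self {x : ℝ} (hx : 0 ≤ x) : (Real.sqrt x : ℂ) * Real.sqrt x = x := by
  rw [← ofReal_mul, Real.mul_self_sqrt hx]

lemma mul_suRadial (κ : ℝ) (m : ℕ) :
    (m : ℂ) * suRadial κ m = Real.sqrt (m * (m - 1 + 2 * κ)) * suRadial κ (m - 1) := by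
  cases m with
  | zero => simp
  | succ m =>
    simp only [suRadial, Nat.add_sub_cancel]
    rw [← ofReal_natCast, ← ofReal_mul, ← ofReal_mul, ← mul_assoc]
    congr 2
    -- Only the square `(m + 1)²` is taken out of the root, so the sign of `m + 2κ` is irrelevant.
    have h : ((m + 1 : ℕ) : ℝ) * (((m + 1 : ℕ) : ℝ) - 1 + 2 * κ)
        = (m + 1) ^ 2 * ((m + 2 * κ) / (m + 1)) := by
      push_cast; field_simp; ring
    rw [h, Real.sqrt_mul (by positivity), Real.sqrt_sq (by positivity)]
    push_cast; rfl

lemma sqrt_mul_suRadial_succ {κ : ℝ} (hκ : 0 < κ) (m : ℕ) :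
    (Real.sqrt ((m + 1) * (m + 2 * κ)) : ℂ) * suRadial κ (m + 1)
      = (m + 2 * κ) * suRadial κ m := by
  simp only [suRadial]
  norm_cast
  rw [← mul_assoc, ← Real.sqrt_mul (by positivity)]
  congr 1
  have h : ((m : ℝ) + 1) * (m + 2 * κ) * ((m + 2 * κ) / (m + 1)) = (m + 2 * κ) ^ 2 := by
    field_simp
  push_cast
  rw [h, Real.sqrt_sq (by positivity)]

/-- From `√n / √(n-1)! = n / √n!`; the right side is the form in which `∂_z` of the coefficient
appears. -/
lemma opAd_cohCoeff (k : ℝ) (z w : ℂ) (n m : ℕ) :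
    opAd (cohCoeff k z w) (n, m) = n * hermiteTwo z w (n - 1) / (Real.sqrt (n.factorial) : ℂ) *
      (suRadial (k - 1 / 4) m * w ^ m) := by
  cases n with
  | zero => simp [opAd]
  | succ n =>
    simp only [opAd, cohCoeff, LinearMap.coe_mk, AddHom.coe_mk, Nat.add_sub_cancel]
    rw [sqrt_factorial_succ]
    have h1 := sqrt_factorial_ne_zero n
    have h2 : (Real.sqrt (n + 1) : ℂ) ≠ 0 := by
      exact_mod_cast (Real.sqrt_pos.2 (by positivity : (0 : ℝ) < n + 1)).ne'
    have h3 := ofReal_sqrt_mul_self (by positivity : (0 : ℝ) ≤ n + 1)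
    generalize (suRadial (k - 1 / 4) m : ℂ) = r
    push_cast at h3 ⊢
    field_simp
    linear_combination (hermiteTwo z w n * r * w ^ m) * h3

lemma opAd_sq_cohCoeff (k : ℝ) (z w : ℂ) (n m : ℕ) :
    (opAd ^ 2) (cohCoeff k z w) (n, m)
      = n * (n - 1) * hermiteTwo z w (n - 2) / (Real.sqrt (n.factorial) : ℂ) *
      (suRadial (k - 1 / 4) m * w ^ m) := by
  cases n with
  | zero => simp [pow_two, opAd]
  | succ n =>
    have h : (opAd ^ 2) (cohCoeff k z w) (n + 1, m)
        = Real.sqrt (n + 1) * opAd (cohCoeff k z w) (n, m) := by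
      simp [pow_two, opAd]
    rw [h, opAd_cohCoeff, sqrt_factorial_succ]
    have h1 := sqrt_factorial_ne_zero n
    have h2 : (Real.sqrt (n + 1) : ℂ) ≠ 0 := by
      exact_mod_cast (Real.sqrt_pos.2 (by positivity : (0 : ℝ) < n + 1)).ne'
    have h3 := ofReal_sqrt_mul_self (by positivity : (0 : ℝ) ≤ n + 1)
    simp only [show n + 1 - 2 = n - 1 from rfl]
    generalize (suRadial (k - 1 / 4) m : ℂ) = r
    push_cast at h3 ⊢
    field_simp
    linear_combination (n * hermiteTwo z w (n - 1) * r * w ^ m) * h3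

lemma opKp'_cohCoeff (k : ℝ) (z w : ℂ) (n m : ℕ) :
    opKp' (k - 1 / 4) (cohCoeff k z w) (n, m)
      = hermiteTwo z w n / (Real.sqrt (n.factorial) : ℂ) *
      (suRadial (k - 1 / 4) m * (m * w ^ (m - 1))) := by
  have h := mul_suRadial (k - 1 / 4) m
  simp only [opKp', cohCoeff, LinearMap.coe_mk, AddHom.coe_mk]
  linear_combination
    (-(hermiteTwo z w n / (Real.sqrt (n.factorial) : ℂ) * w ^ (m - 1))) * h

/-- The coefficientwise form of `∂_z e = a† e` and `∂_w e = K_+ e`. The term `(a†)²/2` of `K_+`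
differentiates the Hermite factor, and `K'_+` the power of `w`. -/
lemma hasFDerivAt_cohCoeff (k : ℝ) (p : Fin 2 → ℂ) (q : ℕ × ℕ) :
    HasFDerivAt (fun p : Fin 2 → ℂ => cohCoeff k (p 0) (p 1) q)
      (formTwo (opAd (cohCoeff k (p 0) (p 1)) q) (opKp k (cohCoeff k (p 0) (p 1)) q)) p := by
  obtain ⟨n, m⟩ := q
  have h1 : HasFDerivAt (fun p : Fin 2 → ℂ => p 1) (ContinuousLinearMap.proj 1 : _ →L[ℂ] ℂ) p :=
    hasFDerivAt_apply 1 p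
  have hP := hasFDerivAt_hermiteTwo p n
  refine ((hP.mul_const ((Real.sqrt (n.factorial) : ℂ))⁻¹).mul
    ((h1.pow m).const_mul (suRadial (k - 1 / 4) m : ℂ))).congr_fderiv ?_
  refine ContinuousLinearMap.ext fun v => ?_
  have e : opKp k (cohCoeff k (p 0) (p 1)) (n, m)
      = 1 / 2 * (opAd ^ 2) (cohCoeff k (p 0) (p 1)) (n, m)
        + opKp' (k - 1 / 4) (cohCoeff k (p 0) (p 1)) (n, m) := rfl
  rw [formTwo_apply, e, opAd_cohCoeff, opAd_sq_cohCoeff, opKp'_cohCoeff]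
  simp only [formTwo_apply, add_apply, smul_apply,
      ContinuousLinearMap.proj_apply, smul_eq_mul, nsmul_eq_mul]
  ring

lemma cohCoeff_zero (k : ℝ) : cohCoeff k 0 0 = vac := by
  funext q
  obtain ⟨n, m⟩ := q
  cases n with
  | zero => cases m with
    | zero => simp [cohCoeff, hermiteTwo, suRadial, vac]
    | succ m => simp [cohCoeff, vac]
  | succ n =>
    have : ∀ n : ℕ, hermiteTwo (0 : ℂ) 0 (n + 1) = 0 := by
      intro n; rw [hermiteTwo_succ]; simp
    simp [cohCoeff, this, vac]

lemma deriv_cohCoeff_smul (k : ℝ) (z w s : ℂ) (q : ℕ × ℕ) :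
    HasDerivAt (fun s : ℂ => cohCoeff k (s * z) (s * w) q)
      ((z • opAd + w • opKp k) (cohCoeff k (s * z) (s * w)) q) s := by
  have h0 : HasDerivAt (fun s : ℂ => s • ![z, w]) ![z, w] s := by
    simpa using (hasDerivAt_id s).smul_const ![z, w]
  have h := (hasFDerivAt_cohCoeff k (s • ![z, w]) q).comp_hasDerivAt s h0
  have e : formTwo (opAd (cohCoeff k (s * z) (s * w)) q) (opKp k (cohCoeff k (s * z) (s * w)) q)
      ![z, w] = (z • opAd + w • opKp k) (cohCoeff k (s * z) (s * w)) q := by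
    simp [mul_comm]
  rw [← e]
  exact h

/-- The band operators acting on coefficients commute with differentiation in a parameter. -/
def IsBand (T : Module.End ℂ Coeff) : Prop :=
  ∀ (f : ℂ → Coeff) (f' : Coeff) (s : ℂ), (∀ q, HasDerivAt (fun s => f s q) (f' q) s) →
    ∀ q, HasDerivAt (fun s => T (f s) q) (T f' q) s

lemma IsBand.add {S T : Module.End ℂ Coeff} (hS : IsBand S) (hT : IsBand T) : IsBand (S + T) :=
  fun f f' s h q => (hS f f' s h q).add (hT f f' s h q)

lemma IsBand.smul {T : Module.End ℂ Coeff} (c : ℂ) (hT : IsBand T) : IsBand (c • T) :=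
  fun f f' s h q => (hT f f' s h q).const_mul c

lemma IsBand.mul {S T : Module.End ℂ Coeff} (hS : IsBand S) (hT : IsBand T) : IsBand (S * T) :=
  fun f f' s h q => hS (fun s => T (f s)) (T f') s (hT f f' s h) q

lemma isBand_one : IsBand 1 := fun _ _ _ h q => h q

lemma IsBand.pow {T : Module.End ℂ Coeff} (hT : IsBand T) (N : ℕ) : IsBand (T ^ N) := by
  induction N with
  | zero => simpa using isBand_one
  | succ N ih => rw [pow_succ]; exact ih.mul hT

lemma isBand_opAd : IsBand opAd := fun _ _ _ h q => (h (q.1 - 1, q.2)).const_mul _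

lemma isBand_opKp' (κ : ℝ) : IsBand (opKp' κ) := fun _ _ _ h q => (h (q.1, q.2 - 1)).const_mul _

lemma isBand_opKp (k : ℝ) : IsBand (opKp k) :=
  ((isBand_opAd.pow 2).smul _).add (isBand_opKp' _)

lemma iteratedDeriv_cohCoeff_smul (k : ℝ) (z w : ℂ) (q : ℕ × ℕ) (N : ℕ) :
    iteratedDeriv N (fun s : ℂ => cohCoeff k (s * z) (s * w) q)
      = fun s => ((z • opAd + w • opKp k) ^ N) (cohCoeff k (s * z) (s * w)) q := by
  induction N with
  | zero => simp
  | succ N ih =>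
    rw [iteratedDeriv_succ, ih]
    funext s
    have hT : IsBand (z • opAd + w • opKp k) := (isBand_opAd.smul z).add ((isBand_opKp k).smul w)
    have h := (hT.pow N) (fun s => cohCoeff k (s * z) (s * w)) _ s
      (fun q => deriv_cohCoeff_smul k z w s q) q
    rw [h.deriv, pow_succ]; rfl

/-- Along the ray `s ↦ (s z, s w)` each explicit coefficient is entire, and differentiation in `s`
applies `T = z a† + w K_+`. Its Taylor coefficients at `0` are therefore those of `T^N e_0 / N!`,
and the Taylor series evaluated at `s = 1` is the exponential series. -/
theorem coh_eq_cohCoeff (k : ℝ) (z w : ℂ) : coh k z w = cohCoeff k z w := by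
  refine HasSum.tsum_eq (Pi.hasSum.2 fun q => ?_)
  have h := Complex.hasSum_taylorSeries_of_entire
    (f := fun s : ℂ => cohCoeff k (s * z) (s * w) q)
    (fun s => (deriv_cohCoeff_smul k z w s q).differentiableAt) 0 1
  simp only [iteratedDeriv_cohCoeff_smul, zero_mul, cohCoeff_zero, one_mul, sub_zero, one_pow,
    one_smul] at h
  exact h

/-! ## Action of the generators on the coherent state vectors -/

/-- The canonical commutation relation, which reduces `a² e` to terms in `e`, `a† e` and `(a†)² e`.
-/
lemma opA_opAd (f : Coeff) : opA (opAd f) = opAd (opA f) + f := by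
  funext q
  obtain ⟨n, m⟩ := q
  have h3 := ofReal_sqrt_mul_self (by positivity : (0 : ℝ) ≤ n + 1)
  cases n with
  | zero => simp [opA, opAd]
  | succ n =>
    have h4 := ofReal_sqrt_mul_self (by positivity : (0 : ℝ) ≤ n + 1)
    simp only [opA, opAd, LinearMap.coe_mk, AddHom.coe_mk, Pi.add_apply, Nat.add_sub_cancel]
    push_cast at h3 h4 ⊢
    linear_combination (f (n + 1, m)) * h3 - (f (n + 1, m)) * h4

/-- In coefficients this is the three-term recurrence of the Hermite polynomials. -/
lemma opA_coh (k : ℝ) (z w : ℂ) :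
    opA (coh k z w) = z • coh k z w + w • opAd (coh k z w) := by
  rw [coh_eq_cohCoeff]
  funext q
  obtain ⟨n, m⟩ := q
  simp only [Pi.add_apply, Pi.smul_apply, smul_eq_mul, opAd_cohCoeff]
  simp only [opA, cohCoeff, LinearMap.coe_mk, AddHom.coe_mk]
  rw [sqrt_factorial_succ, hermiteTwo_succ]
  have h1 := sqrt_factorial_ne_zero n
  have h2 : (Real.sqrt (n + 1) : ℂ) ≠ 0 := by
    exact_mod_cast (Real.sqrt_pos.2 (by positivity : (0 : ℝ) < n + 1)).ne'
  field_simp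

lemma opK0'_coh (k : ℝ) (z w : ℂ) :
    opK0' (k - 1 / 4) (coh k z w)
      = (k - 1 / 4 : ℂ) • coh k z w + w • opKp' (k - 1 / 4) (coh k z w) := by
  rw [coh_eq_cohCoeff]
  funext q
  obtain ⟨n, m⟩ := q
  simp only [Pi.add_apply, Pi.smul_apply, smul_eq_mul, opKp'_cohCoeff]
  simp only [opK0', cohCoeff, LinearMap.coe_mk, AddHom.coe_mk]
  cases m with
  | zero => simp
  | succ m => simp only [Nat.add_sub_cancel]; push_cast; ring

lemma opKm'_coh {k : ℝ} (hk : 1 / 4 < k) (z w : ℂ) :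
    opKm' (k - 1 / 4) (coh k z w)
      = (2 * (k - 1 / 4) * w : ℂ) • coh k z w + w ^ 2 • opKp' (k - 1 / 4) (coh k z w) := by
  rw [coh_eq_cohCoeff]
  funext q
  obtain ⟨n, m⟩ := q
  simp only [Pi.add_apply, Pi.smul_apply, smul_eq_mul, opKp'_cohCoeff]
  have h := sqrt_mul_suRadial_succ (sub_pos.2 hk) m
  simp only [opKm', cohCoeff, LinearMap.coe_mk, AddHom.coe_mk]
  push_cast at h
  cases m with
  | zero =>
    simp at h ⊢
    linear_combination (hermiteTwo z w n / (Real.sqrt (n.factorial) : ℂ) * w) * h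
  | succ m =>
    simp only [Nat.add_sub_cancel]
    linear_combination (hermiteTwo z w n / (Real.sqrt (n.factorial) : ℂ) * w ^ (m + 2)) * h

lemma opK0_coh (k : ℝ) (z w : ℂ) :
    opK0 k (coh k z w)
      = (k : ℂ) • coh k z w + (z / 2) • opAd (coh k z w) + w • opKp k (coh k z w) := by
  have e : opK0 k (coh k z w) = (1 / 2 : ℂ) • (opAd (opA (coh k z w)) + (1 / 2 : ℂ) • coh k z w)
      + opK0' (k - 1 / 4) (coh k z w) := rfl
  have e' : opKp k (coh k z w) = (1 / 2 : ℂ) • opAd (opAd (coh k z w))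
      + opKp' (k - 1 / 4) (coh k z w) := by simp [opKp, pow_two]
  rw [e, e', opA_coh, opK0'_coh, map_add, map_smul, map_smul]
  module

lemma opKm_coh {k : ℝ} (hk : 1 / 4 < k) (z w : ℂ) :
    opKm k (coh k z w) = (z ^ 2 / 2 + 2 * k * w) • coh k z w + (z * w) • opAd (coh k z w)
      + w ^ 2 • opKp k (coh k z w) := by
  have e : opKm k (coh k z w) = (1 / 2 : ℂ) • opA (opA (coh k z w))
      + opKm' (k - 1 / 4) (coh k z w) := by simp [opKm, pow_two]
  have e' : opKp k (coh k z w) = (1 / 2 : ℂ) • opAd (opAd (coh k z w))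
      + opKp' (k - 1 / 4) (coh k z w) := by simp [opKp, pow_two]
  rw [e, e', opKm'_coh hk, opA_coh, map_add, map_smul, map_smul, opA_opAd, opA_coh, map_add,
    map_smul, map_smul]
  module

/-- The coefficient of `∂/∂z` in the action of a linear Hamiltonian on `e_{z,w}`. -/
def fieldZ (ca cd c0 cm z w : ℂ) : ℂ := cd + ca * w + (c0 / 2 + cm * w) * z

/-- The coefficient of `∂/∂w` in the action of a linear Hamiltonian on `e_{z,w}`. -/
def fieldW (c0 cp cm w : ℂ) : ℂ := cp + c0 * w + cm * w ^ 2

/-- The multiplication term in the action of a linear Hamiltonian on `e_{z,w}`. -/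
def fieldOne (k : ℝ) (ca c0 cm z w : ℂ) : ℂ := ca * z + c0 * k + cm * (z ^ 2 / 2 + 2 * k * w)

/-- As `a† e = ∂_z e` and `K_+ e = ∂_w e`, this is the first-order differential operator on which
both the classical and the quantum computation rest. -/
lemma linHam_coh {k : ℝ} (hk : 1 / 4 < k) (ca cd c0 cp cm z w : ℂ) :
    linHam k ca cd c0 cp cm (coh k z w) = fieldOne k ca c0 cm z w • coh k z w
      + fieldZ ca cd c0 cm z w • opAd (coh k z w) + fieldW c0 cp cm w • opKp k (coh k z w) := by
  have e : linHam k ca cd c0 cp cm (coh k z w) = ca • opA (coh k z w) + cd • opAd (coh k z w)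
    + c0 • opK0 k (coh k z w) + cp • opKp k (coh k z w) + cm • opKm k (coh k z w) := rfl
  rw [e, opA_coh, opK0_coh, opKm_coh hk, fieldOne, fieldZ, fieldW]
  module

/-! ## Geometrically decaying coefficient families -/

/-- Coefficient families decaying geometrically in the total degree. -/
def geomDecay : Submodule ℂ Coeff where
  carrier := {f | ∃ C r : ℝ, 0 < r ∧ r < 1 ∧ ∀ q, ‖f q‖ ≤ C * r ^ (q.1 + q.2)}
  zero_mem' := ⟨0, 1 / 2, by norm_num, by norm_num, by simp⟩
  add_mem' := by
    rintro f g ⟨C, r, hr, hr1, hf⟩ ⟨D, s, hs, hs1, hg⟩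
    have hC : 0 ≤ C := by simpa using (norm_nonneg _).trans (hf (0, 0))
    have hD : 0 ≤ D := by simpa using (norm_nonneg _).trans (hg (0, 0))
    refine ⟨C + D, max r s, lt_max_of_lt_left hr, max_lt hr1 hs1, fun q => ?_⟩
    calc ‖f q + g q‖ ≤ ‖f q‖ + ‖g q‖ := norm_add_le _ _
      _ ≤ C * r ^ (q.1 + q.2) + D * s ^ (q.1 + q.2) := add_le_add (hf q) (hg q)
      _ ≤ C * max r s ^ (q.1 + q.2) + D * max r s ^ (q.1 + q.2) := by
        gcongr
        · exact le_max_left _ _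
        · exact le_max_right _ _
      _ = _ := by ring
  smul_mem' := by
    rintro c f ⟨C, r, hr, hr1, hf⟩
    refine ⟨‖c‖ * C, r, hr, hr1, fun q => ?_⟩
    rw [Pi.smul_apply, norm_smul, mul_assoc]
    exact mul_le_mul_of_nonneg_left (hf q) (norm_nonneg _)

lemma summable_norm_of_geomDecay {f : Coeff} (hf : f ∈ geomDecay) : Summable fun q => ‖f q‖ := by
  obtain ⟨C, r, hr, hr1, hf⟩ := hf
  refine Summable.of_nonneg_of_le (fun _ => norm_nonneg _) hf ?_
  have h := summable_geometric_of_lt_one hr.le hr1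
  simpa [pow_add] using (h.mul_of_nonneg h (fun _ => by positivity) fun _ => by positivity).mul_left C

lemma memℓp_of_geomDecay {f : Coeff} (hf : f ∈ geomDecay) : Memℓp f 2 := by
  have h1 : Memℓp f 1 := memℓp_gen (by simpa using summable_norm_of_geomDecay hf)
  exact h1.of_exponent_ge (by norm_num)

lemma exists_succ_mul_pow_le {r s : ℝ} (hr : 0 < r) (hrs : r < s) :
    ∃ C : ℝ, ∀ n : ℕ, (n + 1) * r ^ n ≤ C * s ^ n := by
  have hs : 0 < s := hr.trans hrs
  have h1 : |r / s| < 1 := by rw [abs_of_pos (by positivity), div_lt_one hs]; exact hrs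
  have ht : Tendsto (fun n : ℕ => ((n : ℝ) + 1) * (r / s) ^ n) atTop (𝓝 0) := by
    have a := tendsto_self_mul_const_pow_of_abs_lt_one h1
    have b := tendsto_pow_atTop_nhds_zero_of_abs_lt_one h1
    simpa [add_mul] using a.add b
  obtain ⟨C, hC⟩ := ht.bddAbove_range
  refine ⟨C, fun n => ?_⟩
  have := hC ⟨n, rfl⟩
  simp only [div_pow] at this
  rwa [mul_div_assoc', div_le_iff₀ (by positivity)] at this

/-- Covers all generators used here: matrix entries grow at most linearly and the degree read off is
lower by at most one. The shift costs a factor `1 / r`, and the linear growth is absorbed by passing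
from `r` to a ratio `s` in `(r, 1)`. -/
lemma geomDecay_of_le {f g : Coeff} (hf : f ∈ geomDecay) (σ : ℕ × ℕ → ℕ × ℕ) (B : ℝ) (hB : 0 ≤ B)
    (hg : ∀ q, ‖g q‖ ≤ B * (q.1 + q.2 + 1) * ‖f (σ q)‖)
    (hσ : ∀ q, q.1 + q.2 ≤ (σ q).1 + (σ q).2 + 1) : g ∈ geomDecay := by
  obtain ⟨C, r, hr, hr1, hf⟩ := hf
  have hC : 0 ≤ C := by simpa using (norm_nonneg _).trans (hf (0, 0))
  obtain ⟨s, hrs, hs1⟩ := exists_between hr1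
  obtain ⟨D, hD⟩ := exists_succ_mul_pow_le hr hrs
  refine ⟨B * C / r * D, s, hr.trans hrs, hs1, fun q => ?_⟩
  have h1 : r ^ ((σ q).1 + (σ q).2) ≤ r ^ (q.1 + q.2) / r := by
    rw [le_div_iff₀ hr, ← pow_succ]
    exact pow_le_pow_of_le_one hr.le hr1.le (hσ q)
  have h2 := hD (q.1 + q.2)
  push_cast at h2
  calc ‖g q‖ ≤ B * (q.1 + q.2 + 1) * ‖f (σ q)‖ := hg q
    _ ≤ B * (q.1 + q.2 + 1) * (C * (r ^ (q.1 + q.2) / r)) := by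
      gcongr
      exact (hf _).trans (mul_le_mul_of_nonneg_left h1 hC)
    _ = B * C / r * ((q.1 + q.2 + 1) * r ^ (q.1 + q.2)) := by ring
    _ ≤ B * C / r * (D * s ^ (q.1 + q.2)) := by gcongr
    _ = _ := by ring

lemma sqrt_le_of_le_of_one_le {x y : ℝ} (hy : 1 ≤ y) (h : x ≤ y) : Real.sqrt x ≤ y :=
  Real.sqrt_le_iff.2 ⟨by linarith, by nlinarith⟩

lemma opA_mem_geomDecay {f : Coeff} (hf : f ∈ geomDecay) : opA f ∈ geomDecay := by
  refine geomDecay_of_le hf (fun q => (q.1 + 1, q.2)) 1 zero_le_one (fun q => ?_) fun q => by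
    simp only; omega
  simp only [opA, LinearMap.coe_mk, AddHom.coe_mk, norm_mul, norm_real, Real.norm_eq_abs,
    abs_of_nonneg (Real.sqrt_nonneg _)]
  gcongr
  have h1 : (0 : ℝ) ≤ q.1 := by positivity
  have h2 : (0 : ℝ) ≤ q.2 := by positivity
  exact sqrt_le_of_le_of_one_le (by linarith) (by linarith)

lemma opAd_mem_geomDecay {f : Coeff} (hf : f ∈ geomDecay) : opAd f ∈ geomDecay := by
  refine geomDecay_of_le hf (fun q => (q.1 - 1, q.2)) 1 zero_le_one (fun q => ?_) fun q => by
    simp only; omega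
  simp only [opAd, LinearMap.coe_mk, AddHom.coe_mk, norm_mul, norm_real, Real.norm_eq_abs,
    abs_of_nonneg (Real.sqrt_nonneg _)]
  gcongr
  have h1 : (0 : ℝ) ≤ q.1 := by positivity
  have h2 : (0 : ℝ) ≤ q.2 := by positivity
  exact sqrt_le_of_le_of_one_le (by linarith) (by linarith)

lemma opKp'_mem_geomDecay (κ : ℝ) {f : Coeff} (hf : f ∈ geomDecay) :
    opKp' κ f ∈ geomDecay := by
  refine geomDecay_of_le hf (fun q => (q.1, q.2 - 1)) (1 + 2 * |κ|) (by positivity)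
    (fun q => ?_) fun q => by simp only; omega
  simp only [opKp', LinearMap.coe_mk, AddHom.coe_mk, norm_mul, norm_real, Real.norm_eq_abs,
    abs_of_nonneg (Real.sqrt_nonneg _)]
  gcongr
  have h1 : (0 : ℝ) ≤ q.1 := by positivity
  have h2 : (0 : ℝ) ≤ q.2 := by positivity
  have h3 := le_abs_self κ
  have h4 := abs_nonneg κ
  refine Real.sqrt_le_iff.2 ⟨by positivity, ?_⟩
  have h5 : (q.2 : ℝ) ≤ q.1 + q.2 + 1 := by linarith
  have h6 : (q.2 : ℝ) - 1 + 2 * κ ≤ (1 + 2 * |κ|) * (q.1 + q.2 + 1) := by nlinarith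
  have h7 : (q.2 : ℝ) ≤ (1 + 2 * |κ|) * (q.1 + q.2 + 1) := by nlinarith
  calc (q.2 : ℝ) * (q.2 - 1 + 2 * κ) ≤ q.2 * ((1 + 2 * |κ|) * (q.1 + q.2 + 1)) := by gcongr
    _ ≤ ((1 + 2 * |κ|) * (q.1 + q.2 + 1)) * ((1 + 2 * |κ|) * (q.1 + q.2 + 1)) := by gcongr
    _ = _ := by ring

lemma opKp_mem_geomDecay (k : ℝ) {f : Coeff} (hf : f ∈ geomDecay) : opKp k f ∈ geomDecay :=
  geomDecay.add_mem (geomDecay.smul_mem _ (opAd_mem_geomDecay (opAd_mem_geomDecay hf)))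
    (opKp'_mem_geomDecay _ hf)

/-! ## Decay of the coherent state vectors -/

/-- The condition `δ r + y ≤ r²` says that `r ^ n` is a supersolution of the recurrence, so a bound
on the initial terms propagates. -/
lemma exists_le_mul_pow_of_recurrence {a : ℕ → ℝ} {δ y r : ℝ} (hδ : 0 ≤ δ) (hy : 0 ≤ y)
    (hr : 0 < r) (hle : δ * r + y ≤ r ^ 2) (ha : ∀ n, 0 ≤ a n) {N : ℕ}
    (h : ∀ n, N ≤ n → a (n + 2) ≤ δ * a (n + 1) + y * a n) :
    ∃ C : ℝ, 0 ≤ C ∧ ∀ n, a n ≤ C * r ^ n := by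
  -- The sum dominates each ratio `a i / r ^ i` with `i < N + 2`, that is, all terms the recurrence
  -- does not reach.
  set C := ∑ i ∈ Finset.range (N + 2), a i / r ^ i with hC
  have hC0 : 0 ≤ C := Finset.sum_nonneg fun i _ => div_nonneg (ha i) (by positivity)
  have hsmall : ∀ n, n < N + 2 → a n ≤ C * r ^ n := fun n hn => by
    rw [← div_le_iff₀ (by positivity)]
    exact Finset.single_le_sum (f := fun i => a i / r ^ i)
      (fun i _ => div_nonneg (ha i) (by positivity)) (Finset.mem_range.2 hn)
  refine ⟨C, hC0, fun n => ?_⟩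
  induction n using Nat.twoStepInduction with
  | zero => exact hsmall 0 (by omega)
  | one => exact hsmall 1 (by omega)
  | more n ih0 ih1 =>
    by_cases hn : N ≤ n
    · calc a (n + 2) ≤ δ * a (n + 1) + y * a n := h n hn
        _ ≤ δ * (C * r ^ (n + 1)) + y * (C * r ^ n) := by gcongr
        _ = C * r ^ n * (δ * r + y) := by ring
        _ ≤ C * r ^ n * r ^ 2 := by gcongr
        _ = _ := by ring
    · exact hsmall _ (by omega)

lemma hermiteTwo_nonneg {x y : ℝ} (hx : 0 ≤ x) (hy : 0 ≤ y) (n : ℕ) : 0 ≤ hermiteTwo x y n := by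
  induction n using Nat.twoStepInduction with
  | zero => simp [hermiteTwo]
  | one => simpa [hermiteTwo]
  | more n ih0 ih1 => simp only [hermiteTwo]; positivity

lemma norm_hermiteTwo_le {z w : ℂ} {x y : ℝ} (hx : ‖z‖ ≤ x) (hy : ‖w‖ ≤ y) (n : ℕ) :
    ‖hermiteTwo z w n‖ ≤ hermiteTwo x y n := by
  have hx0 := (norm_nonneg _).trans hx
  have hy0 := (norm_nonneg _).trans hy
  induction n using Nat.twoStepInduction with
  | zero => simp [hermiteTwo]
  | one => simpa [hermiteTwo]
  | more n ih0 ih1 =>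
    simp only [hermiteTwo]
    refine (norm_add_le _ _).trans ?_
    rw [norm_mul, norm_mul, norm_mul]
    have : ‖(n : ℂ) + 1‖ = n + 1 := by
      rw [← Nat.cast_succ, Complex.norm_natCast]; push_cast; rfl
    rw [this]
    have := hermiteTwo_nonneg hx0 hy0 n
    gcongr

/-- After division by `√n!` the recurrence has coefficients `x / √(n+2) → 0` and `y √((n+1)/(n+2)) ≤
y`, so any ratio `r < 1` with `r² > y` works eventually. -/
lemma exists_hermiteTwo_le {x y : ℝ} (hx : 0 ≤ x) (hy : 0 ≤ y) (hy1 : y < 1) :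
    ∃ C r : ℝ, 0 ≤ C ∧ 0 < r ∧ r < 1 ∧
      ∀ n : ℕ, hermiteTwo x y n / Real.sqrt n.factorial ≤ C * r ^ n := by
  set r := (1 + y) / 2 with hr
  have hr0 : 0 < r := by positivity
  -- Here `r² - y = ((1 - y) / 2)²`; `δ` below is then chosen so that `δ r + y = r²`.
  have hyr : y < r ^ 2 := by rw [hr]; nlinarith [sq_pos_of_pos (sub_pos.2 hy1)]
  set δ := (r ^ 2 - y) / r with hδ
  have hδ0 : 0 < δ := div_pos (by linarith) hr0
  have ht : Tendsto (fun n : ℕ => x / Real.sqrt ((n : ℝ) + 2)) atTop (𝓝 0) :=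
    Tendsto.div_atTop tendsto_const_nhds (Real.tendsto_sqrt_atTop.comp
      (tendsto_atTop_add_const_right _ _ tendsto_natCast_atTop_atTop))
  obtain ⟨N, hN⟩ := eventually_atTop.1 (ht.eventually_le_const hδ0)
  have key : ∀ n, N ≤ n → hermiteTwo x y (n + 2) / Real.sqrt (n + 2).factorial
      ≤ δ * (hermiteTwo x y (n + 1) / Real.sqrt (n + 1).factorial)
        + y * (hermiteTwo x y n / Real.sqrt n.factorial) := fun n hn => by
    have hP0 := hermiteTwo_nonneg hx hy n
    have hP1 := hermiteTwo_nonneg hx hy (n + 1)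
    have s0 : 0 < Real.sqrt n.factorial := Real.sqrt_pos.2 (by positivity)
    have s1 : 0 < Real.sqrt ((n : ℝ) + 1) := Real.sqrt_pos.2 (by positivity)
    have s2 : 0 < Real.sqrt ((n : ℝ) + 2) := Real.sqrt_pos.2 (by positivity)
    have e1 : Real.sqrt (n + 1).factorial = Real.sqrt (n + 1) * Real.sqrt n.factorial := by
      exact_mod_cast sqrt_factorial_succ n
    have e2 : Real.sqrt (n + 2).factorial = Real.sqrt (n + 2) * Real.sqrt (n + 1).factorial := by
      have := sqrt_factorial_succ (n + 1)
      rw [← ofReal_mul] at this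
      have := ofReal_injective this
      rw [this]; push_cast; ring_nf
    have e3 := Real.mul_self_sqrt (by positivity : (0 : ℝ) ≤ n + 1)
    have hle : Real.sqrt ((n : ℝ) + 1) / Real.sqrt (n + 2) ≤ 1 :=
      (div_le_one s2).2 (Real.sqrt_le_sqrt (by linarith))
    calc hermiteTwo x y (n + 2) / Real.sqrt (n + 2).factorial
        = x / Real.sqrt (n + 2) * (hermiteTwo x y (n + 1) / Real.sqrt (n + 1).factorial)
          + y * (Real.sqrt (n + 1) / Real.sqrt (n + 2))
            * (hermiteTwo x y n / Real.sqrt n.factorial) := by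
          rw [e2, e1]
          simp only [hermiteTwo]
          field_simp
          rw [pow_two, e3]; ring
      _ ≤ δ * (hermiteTwo x y (n + 1) / Real.sqrt (n + 1).factorial)
          + y * 1 * (hermiteTwo x y n / Real.sqrt n.factorial) := by
          gcongr
          exact hN n hn
      _ = _ := by ring
  obtain ⟨C, hC, h⟩ := exists_le_mul_pow_of_recurrence
    (a := fun n => hermiteTwo x y n / Real.sqrt n.factorial) hδ0.le hy hr0
    (by rw [hδ]; field_simp; linarith)
    (fun n => div_nonneg (hermiteTwo_nonneg hx hy n) (Real.sqrt_nonneg _)) key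
  exact ⟨C, r, hC, hr0, by linarith, h⟩

lemma suRadial_nonneg (κ : ℝ) (m : ℕ) : 0 ≤ suRadial κ m := by
  induction m with
  | zero => simp [suRadial]
  | succ m ih => simp only [suRadial]; positivity

/-- The ratio of consecutive terms tends to `y`, hence is eventually below any `r` in `(y, 1)`; this
is a two-step recurrence whose second coefficient is `0`. -/
lemma exists_suRadial_le (κ : ℝ) {y : ℝ} (hy : 0 ≤ y) (hy1 : y < 1) :
    ∃ C r : ℝ, 0 ≤ C ∧ 0 < r ∧ r < 1 ∧ ∀ m : ℕ, suRadial κ m * y ^ m ≤ C * r ^ m := by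
  obtain ⟨r, hyr, hr1⟩ := exists_between hy1
  have hr0 : 0 < r := hy.trans_lt hyr
  have ht : Tendsto (fun m : ℕ => Real.sqrt (((m : ℝ) + 1 + 2 * κ) / (m + 1 + 1)) * y) atTop
      (𝓝 y) := by
    have h1 : Tendsto (fun m : ℕ => ((m : ℝ) + 1 + 2 * κ) / (m + 1 + 1)) atTop (𝓝 1) := by
      have h2 : Tendsto (fun m : ℕ => 1 + (2 * κ - 1) / ((m : ℝ) + 2)) atTop (𝓝 (1 + 0)) :=
        tendsto_const_nhds.add (Tendsto.div_atTop tendsto_const_nhds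
          (tendsto_atTop_add_const_right _ _ tendsto_natCast_atTop_atTop))
      rw [add_zero] at h2
      refine h2.congr fun m => ?_
      have : (m : ℝ) + 2 ≠ 0 := by positivity
      have : (m : ℝ) + 1 + 1 ≠ 0 := by positivity
      field_simp
      ring
    simpa using (h1.sqrt).mul_const y
  obtain ⟨N, hN⟩ := eventually_atTop.1 (ht.eventually_le_const hyr)
  have key : ∀ m, N ≤ m → suRadial κ (m + 2) * y ^ (m + 2)
      ≤ r * (suRadial κ (m + 1) * y ^ (m + 1)) + 0 * (suRadial κ m * y ^ m) := fun m hm => by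
    have h1 := mul_nonneg (suRadial_nonneg κ (m + 1)) (pow_nonneg hy (m + 1))
    have h2 := mul_le_mul_of_nonneg_right (hN m hm) h1
    calc suRadial κ (m + 2) * y ^ (m + 2)
        = Real.sqrt (((m : ℝ) + 1 + 2 * κ) / (m + 1 + 1)) * y
          * (suRadial κ (m + 1) * y ^ (m + 1)) := by
          simp only [suRadial]; push_cast; ring
      _ ≤ _ := by rw [zero_mul, add_zero]; exact h2
  obtain ⟨C, hC, h⟩ := exists_le_mul_pow_of_recurrence
    (a := fun m => suRadial κ m * y ^ m) hr0.le le_rfl hr0 (by rw [add_zero, pow_two])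
    (fun m => mul_nonneg (suRadial_nonneg κ m) (by positivity)) key
  exact ⟨C, r, hC, hr0, hr1, h⟩

lemma norm_coh_le (k : ℝ) {z w : ℂ} {x y : ℝ} (hx : ‖z‖ ≤ x) (hy : ‖w‖ ≤ y) (q : ℕ × ℕ) :
    ‖coh k z w q‖ ≤ hermiteTwo x y q.1 / Real.sqrt q.1.factorial *
      (suRadial (k - 1 / 4) q.2 * y ^ q.2) := by
  have := (norm_nonneg _).trans (norm_hermiteTwo_le hx hy q.1)
  have := suRadial_nonneg (k - 1 / 4) q.2
  rw [coh_eq_cohCoeff, cohCoeff, norm_mul, norm_mul, norm_div, norm_pow, norm_real, norm_real,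
    Real.norm_of_nonneg (Real.sqrt_nonneg _), Real.norm_of_nonneg this]
  gcongr
  exact norm_hermiteTwo_le hx hy q.1

/-- A majorant of the vectors `e_{z,w}` with `|z| ≤ x`, `|w| ≤ y`. -/
def cohMajorant (k x y : ℝ) : Coeff := fun q =>
  ((hermiteTwo x y q.1 / Real.sqrt q.1.factorial * (suRadial (k - 1 / 4) q.2 * y ^ q.2) : ℝ) : ℂ)

lemma cohMajorant_mem_geomDecay (k : ℝ) {x y : ℝ} (hx : 0 ≤ x) (hy : 0 ≤ y) (hy1 : y < 1) :
    cohMajorant k x y ∈ geomDecay := by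
  obtain ⟨C, r, hC, hr, hr1, h⟩ := exists_hermiteTwo_le hx hy hy1
  obtain ⟨D, s, hD, hs, hs1, h'⟩ := exists_suRadial_le (k - 1 / 4) hy hy1
  refine ⟨C * D, max r s, lt_max_of_lt_left hr, max_lt hr1 hs1, fun q => ?_⟩
  have h0 := mul_nonneg (suRadial_nonneg (k - 1 / 4) q.2) (pow_nonneg hy q.2)
  rw [cohMajorant, norm_real, Real.norm_of_nonneg (mul_nonneg
    (div_nonneg (hermiteTwo_nonneg hx hy _) (Real.sqrt_nonneg _)) h0)]
  calc _ ≤ C * r ^ q.1 * (D * s ^ q.2) := mul_le_mul (h _) (h' _) h0 (by positivity)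
    _ ≤ C * max r s ^ q.1 * (D * max r s ^ q.2) := by
      gcongr
      · exact le_max_left _ _
      · exact le_max_right _ _
    _ = _ := by ring

lemma norm_coh_le_majorant (k : ℝ) {z w : ℂ} {x y : ℝ} (hx : ‖z‖ ≤ x) (hy : ‖w‖ ≤ y)
    (q : ℕ × ℕ) : ‖coh k z w q‖ ≤ ‖cohMajorant k x y q‖ := by
  rw [cohMajorant, norm_real]
  exact (norm_coh_le k hx hy q).trans (Real.le_norm_self _)

lemma coh_mem_geomDecay (k : ℝ) (z : ℂ) {w : ℂ} (hw : ‖w‖ < 1) : coh k z w ∈ geomDecay := by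
  refine geomDecay_of_le (cohMajorant_mem_geomDecay k (norm_nonneg z) (norm_nonneg w) hw) id 1
    zero_le_one (fun q => ?_) (fun q => by simp)
  have h := norm_coh_le_majorant k (le_refl ‖z‖) (le_refl ‖w‖) q
  refine h.trans (le_mul_of_one_le_left (norm_nonneg _) ?_)
  have h1 : (0 : ℝ) ≤ q.1 := by positivity
  have h2 : (0 : ℝ) ≤ q.2 := by positivity
  linarith

lemma linHam_coh_mem_geomDecay {k : ℝ} (hk : 1 / 4 < k) (ca cd c0 cp cm z : ℂ) {w : ℂ}
    (hw : ‖w‖ < 1) : linHam k ca cd c0 cp cm (coh k z w) ∈ geomDecay := by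
  have h := coh_mem_geomDecay k z hw
  rw [linHam_coh hk]
  exact geomDecay.add_mem (geomDecay.add_mem (geomDecay.smul_mem _ h)
    (geomDecay.smul_mem _ (opAd_mem_geomDecay h))) (geomDecay.smul_mem _ (opKp_mem_geomDecay k h))

/-! ## The coherent state vectors as a holomorphic map into the Hilbert space -/

open Classical in
/-- The vector of the Hilbert space with given coefficients (zero if they are not in `ℓ²`). -/
def toHilb (f : Coeff) : Hilb := if h : Memℓp f 2 then ⟨f, h⟩ else 0

lemma coe_toHilb {f : Coeff} (hf : Memℓp f 2) : (toHilb f : Coeff) = f := by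
  rw [toHilb, dif_pos hf]

lemma coe_toHilb_of_geomDecay {f : Coeff} (hf : f ∈ geomDecay) : (toHilb f : Coeff) = f :=
  coe_toHilb (memℓp_of_geomDecay hf)

/-- The orthonormal basis vector `φ_n ⊗ e_{k',k'+m}`. -/
def basisVec (q : ℕ × ℕ) : Hilb := lp.single 2 q (1 : ℂ)

lemma norm_basisVec (q : ℕ × ℕ) : ‖basisVec q‖ = 1 := by
  rw [basisVec, lp.norm_single (by norm_num)]; simp

lemma hasSum_basisVec (f : Hilb) : HasSum (fun q => (f : Coeff) q • basisVec q) f := by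
  have h := lp.hasSum_single (by norm_num) f
  refine h.congr_fun fun q => ?_
  rw [basisVec, ← lp.single_smul, smul_eq_mul, mul_one]

lemma norm_formTwo_le (a b : ℂ) : ‖formTwo a b‖ ≤ ‖a‖ + ‖b‖ := by
  refine ContinuousLinearMap.opNorm_le_bound _ (by positivity) fun v => ?_
  rw [formTwo_apply, add_mul]
  refine (norm_add_le _ _).trans ?_
  rw [norm_mul, norm_mul]
  gcongr <;> exact norm_le_pi_norm v _

/-- The vectors `e_{z,w}` in the Hilbert space. -/
def cohHilb (k : ℝ) (p : Fin 2 → ℂ) : Hilb := toHilb (coh k (p 0) (p 1))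

/-- The vectors `∂e_{z,w}/∂z = a† e_{z,w}`. -/
def cohHilbZ (k : ℝ) (p : Fin 2 → ℂ) : Hilb := toHilb (opAd (coh k (p 0) (p 1)))

/-- The vectors `∂e_{z,w}/∂w = K_+ e_{z,w}`. -/
def cohHilbW (k : ℝ) (p : Fin 2 → ℂ) : Hilb := toHilb (opKp k (coh k (p 0) (p 1)))

section
variable {k : ℝ} {p : Fin 2 → ℂ} (hp : ‖p 1‖ < 1)
include hp

lemma coe_cohHilb : (cohHilb k p : Coeff) = coh k (p 0) (p 1) :=
  coe_toHilb_of_geomDecay (coh_mem_geomDecay k _ hp)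

lemma coe_cohHilbZ : (cohHilbZ k p : Coeff) = opAd (coh k (p 0) (p 1)) :=
  coe_toHilb_of_geomDecay (opAd_mem_geomDecay (coh_mem_geomDecay k _ hp))

lemma coe_cohHilbW : (cohHilbW k p : Coeff) = opKp k (coh k (p 0) (p 1)) :=
  coe_toHilb_of_geomDecay (opKp_mem_geomDecay k (coh_mem_geomDecay k _ hp))
end

/-- The vector-valued linear form `v ↦ v₀ x + v₁ y`. -/
def formHilb (x y : Hilb) : (Fin 2 → ℂ) →L[ℂ] Hilb :=
  (ContinuousLinearMap.proj 0 : (Fin 2 → ℂ) →L[ℂ] ℂ).smulRight x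
    + (ContinuousLinearMap.proj 1 : (Fin 2 → ℂ) →L[ℂ] ℂ).smulRight y

@[simp] lemma formHilb_apply (x y : Hilb) (v : Fin 2 → ℂ) :
    formHilb x y v = v 0 • x + v 1 • y := rfl

/-- Identifies the sum of the termwise derivatives in `hasFDerivAt_cohHilb`. -/
lemma hasSum_formTwo_smulRight (x y : Hilb) :
    HasSum (fun q => (formTwo ((x : Coeff) q) ((y : Coeff) q)).smulRight (basisVec q))
      (formHilb x y) := by
  have hx := (hasSum_basisVec x).mapL
    (ContinuousLinearMap.smulRightL ℂ (Fin 2 → ℂ) Hilb (ContinuousLinearMap.proj 0))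
  have hy := (hasSum_basisVec y).mapL
    (ContinuousLinearMap.smulRightL ℂ (Fin 2 → ℂ) Hilb (ContinuousLinearMap.proj 1))
  refine (hx.add hy).congr_fun fun q => ContinuousLinearMap.ext fun v => ?_
  simp [add_smul, smul_smul, mul_comm]

lemma norm_opAd_le {f g : Coeff} (h : ∀ q, ‖f q‖ ≤ ‖g q‖) (q : ℕ × ℕ) :
    ‖opAd f q‖ ≤ ‖opAd g q‖ := by
  simp only [opAd, LinearMap.coe_mk, AddHom.coe_mk, norm_mul]
  gcongr
  exact h _

lemma norm_opKp'_le (κ : ℝ) {f g : Coeff} (h : ∀ q, ‖f q‖ ≤ ‖g q‖) (q : ℕ × ℕ) :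
    ‖opKp' κ f q‖ ≤ ‖opKp' κ g q‖ := by
  simp only [opKp', LinearMap.coe_mk, AddHom.coe_mk, norm_mul]
  gcongr
  exact h _

lemma opKp_apply (k : ℝ) (f : Coeff) :
    opKp k f = (1 / 2 : ℂ) • opAd (opAd f) + opKp' (k - 1 / 4) f := by
  simp [opKp, pow_two]

lemma opKm_apply (k : ℝ) (f : Coeff) :
    opKm k f = (1 / 2 : ℂ) • opA (opA f) + opKm' (k - 1 / 4) f := by
  simp [opKm, pow_two]

lemma norm_opKp_le (k : ℝ) {f g : Coeff} (h : ∀ q, ‖f q‖ ≤ ‖g q‖) (q : ℕ × ℕ) :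
    ‖opKp k f q‖ ≤ ‖opAd (opAd g) q‖ + ‖opKp' (k - 1 / 4) g q‖ := by
  rw [opKp_apply, Pi.add_apply, Pi.smul_apply, smul_eq_mul]
  refine (norm_add_le _ _).trans (add_le_add ?_ (norm_opKp'_le _ h q))
  rw [norm_mul]
  have := norm_opAd_le (norm_opAd_le h) q
  have h2 : ‖(1 / 2 : ℂ)‖ = 1 / 2 := by norm_num
  rw [h2]
  linarith [norm_nonneg (opAd (opAd f) q)]

/-- Termwise differentiation of the expansion in the orthonormal basis. On a polydisc around `p` the
majorant bounds the derivatives of all terms by one summable family; geometric decay gives `ℓ¹`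
summability, so norms of the terms may simply be added. -/
theorem hasFDerivAt_cohHilb (k : ℝ) {p : Fin 2 → ℂ} (hp : ‖p 1‖ < 1) :
    HasFDerivAt (cohHilb k) (formHilb (cohHilbZ k p) (cohHilbW k p)) p := by
  obtain ⟨y, hy, hy1⟩ := exists_between hp
  have hy0 : 0 ≤ y := (norm_nonneg _).trans hy.le
  set x := ‖p 0‖ + 1 with hx
  have hx0 : 0 ≤ x := by positivity
  set s : Set (Fin 2 → ℂ) := {p | ‖p 0‖ < x ∧ ‖p 1‖ < y} with hs
  have hso : IsOpen s := by
    have h0 : IsOpen {p : Fin 2 → ℂ | ‖p 0‖ < x} := isOpen_lt (by fun_prop) continuous_const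
    have h1 : IsOpen {p : Fin 2 → ℂ | ‖p 1‖ < y} := isOpen_lt (by fun_prop) continuous_const
    exact h0.inter h1
  have hsc : IsPreconnected s := by
    have e : s = (ContinuousLinearMap.proj (R := ℝ) (φ := fun _ : Fin 2 => ℂ) 0) ⁻¹' Metric.ball 0 x
        ∩ (ContinuousLinearMap.proj (R := ℝ) (φ := fun _ : Fin 2 => ℂ) 1) ⁻¹' Metric.ball 0 y := by
      ext p; simp [hs]
    rw [e]
    exact (((convex_ball (0 : ℂ) x).linear_preimage _).inter
      ((convex_ball (0 : ℂ) y).linear_preimage _)).isPreconnected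
  have hps : p ∈ s := ⟨by rw [hx]; linarith, hy⟩
  set g := cohMajorant k x y with hg
  have hgd : g ∈ geomDecay := cohMajorant_mem_geomDecay k hx0 hy0 hy1
  have hsum : Summable fun q => ‖opAd g q‖ + (‖opAd (opAd g) q‖ + ‖opKp' (k - 1 / 4) g q‖) :=
    (summable_norm_of_geomDecay (opAd_mem_geomDecay hgd)).add
      ((summable_norm_of_geomDecay (opAd_mem_geomDecay (opAd_mem_geomDecay hgd))).add
        (summable_norm_of_geomDecay (opKp'_mem_geomDecay _ hgd)))
  have hs1 : ∀ p ∈ s, ‖p 1‖ < 1 := fun p hp => hp.2.trans hy1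
  have hexp : ∀ p ∈ s, HasSum (fun q => coh k (p 0) (p 1) q • basisVec q) (cohHilb k p) :=
    fun p hp => by
      have h := hasSum_basisVec (cohHilb k p)
      rwa [coe_cohHilb (hs1 p hp)] at h
  have h := hasFDerivAt_tsum_of_isPreconnected (𝕜 := ℂ)
    (f := fun q (p : Fin 2 → ℂ) => coh k (p 0) (p 1) q • basisVec q)
    (f' := fun q p => (formTwo (opAd (coh k (p 0) (p 1)) q)
      (opKp k (coh k (p 0) (p 1)) q)).smulRight (basisVec q)) hsum hso hsc
    (fun q p _ => by
      have h := hasFDerivAt_cohCoeff k p q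
      simp only [← coh_eq_cohCoeff] at h
      exact h.smul_const _)
    (fun q p hp => by
      rw [ContinuousLinearMap.norm_smulRight_apply, norm_basisVec, mul_one]
      have hle : ∀ q, ‖coh k (p 0) (p 1) q‖ ≤ ‖g q‖ :=
        norm_coh_le_majorant k hp.1.le hp.2.le
      exact (norm_formTwo_le _ _).trans (add_le_add (norm_opAd_le hle q) (norm_opKp_le k hle q)))
    hps (hexp p hps).summable hps
  have h2 := hasSum_formTwo_smulRight (cohHilbZ k p) (cohHilbW k p)
  rw [coe_cohHilbZ hp, coe_cohHilbW hp] at h2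
  rw [h2.tsum_eq] at h
  refine h.congr_of_eventuallyEq ?_
  filter_upwards [hso.mem_nhds hps] with p hp
  exact (hexp p hp).tsum_eq.symm

/-! ## Adjointness relations -/

lemma braket_eq_inner (x y : Hilb) : braket (x : Coeff) (y : Coeff) = inner ℂ x y := by
  rw [lp.inner_eq_tsum, braket]
  refine tsum_congr fun q => ?_
  simp [mul_comm]

lemma summable_braket {f g : Coeff} (hf : f ∈ geomDecay) (hg : g ∈ geomDecay) :
    Summable fun q => conj (f q) * g q := by
  have h := lp.summable_inner (𝕜 := ℂ) (toHilb f) (toHilb g)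
  rw [coe_toHilb_of_geomDecay hf, coe_toHilb_of_geomDecay hg] at h
  refine h.congr fun q => ?_
  simp [mul_comm]

/-- A mere reindexing along an injective shift: `√0` makes the terms outside its range vanish, so no
summability is required. -/
lemma braket_opAd (f g : Coeff) : braket (opAd f) g = braket f (opA g) := by
  have hi : Function.Injective fun q : ℕ × ℕ => (q.1 + 1, q.2) := fun a b h => by
    simp only [Prod.mk.injEq, add_left_inj] at h
    exact Prod.ext h.1 h.2
  rw [braket, ← hi.tsum_eq, braket]
  · refine tsum_congr fun q => ?_
    simp [opAd, opA]; ring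
  · rintro ⟨n, m⟩ hq
    cases n with
    | zero => simp [opAd] at hq
    | succ n => exact ⟨(n, m), rfl⟩

lemma braket_opKp' (κ : ℝ) (f g : Coeff) : braket (opKp' κ f) g = braket f (opKm' κ g) := by
  have hi : Function.Injective fun q : ℕ × ℕ => (q.1, q.2 + 1) := fun a b h => by
    simp only [Prod.mk.injEq, add_left_inj] at h
    exact Prod.ext h.1 h.2
  rw [braket, ← hi.tsum_eq, braket]
  · refine tsum_congr fun q => ?_
    simp only [opKp', opKm', LinearMap.coe_mk, AddHom.coe_mk, Nat.add_sub_cancel, map_mul,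
      conj_ofReal, Nat.cast_succ, add_sub_cancel_right]
    ring
  · rintro ⟨n, m⟩ hq
    cases m with
    | zero => simp [opKp'] at hq
    | succ n => exact ⟨(_, n), rfl⟩

lemma braket_add_right {f g h : Coeff} (hf : f ∈ geomDecay) (hg : g ∈ geomDecay)
    (hh : h ∈ geomDecay) : braket f (g + h) = braket f g + braket f h := by
  rw [braket, braket, braket, ← (summable_braket hf hg).tsum_add (summable_braket hf hh)]
  exact tsum_congr fun q => by rw [Pi.add_apply]; ring

lemma braket_smul_right (c : ℂ) (f g : Coeff) : braket f (c • g) = c * braket f g := by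
  rw [braket, braket, ← tsum_mul_left]
  exact tsum_congr fun q => by rw [Pi.smul_apply, smul_eq_mul]; ring

lemma conj_braket (f g : Coeff) : conj (braket f g) = braket g f := by
  rw [braket, braket, conj_tsum]
  exact tsum_congr fun q => by simp [mul_comm]

lemma braket_opKp {k : ℝ} {f g : Coeff} (hf : f ∈ geomDecay) (hg : g ∈ geomDecay)
    (hm : opKm k g ∈ geomDecay) : braket (opKp k f) g = braket f (opKm k g) := by
  have hA := opAd_mem_geomDecay (opAd_mem_geomDecay hf)
  have hA' := opA_mem_geomDecay (opA_mem_geomDecay hg)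
  -- The decay of `K'_- g` comes from that of `K_- g` and `a² g`; it is needed to split the sum.
  have hK : opKm' (k - 1 / 4) g ∈ geomDecay := by
    have h := geomDecay.sub_mem hm (geomDecay.smul_mem (1 / 2 : ℂ) hA')
    rwa [opKm_apply, add_sub_cancel_left] at h
  rw [opKm_apply, braket_add_right hf (geomDecay.smul_mem _ hA') hK, braket_smul_right,
    ← braket_opAd, ← braket_opAd, ← braket_opKp', ← conj_braket, opKp_apply,
    braket_add_right hg (geomDecay.smul_mem _ hA) (opKp'_mem_geomDecay _ hf), braket_smul_right,
    map_add, map_mul, conj_braket, conj_braket]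
  congr 2
  rw [map_div₀, map_one, conj_ofNat]

/-! ## Wirtinger calculus in two variables -/

/-- The real-linear form `v ↦ a v₀ + b v₁ + c v̄₀ + d v̄₁`. -/
def wirtForm (a b c d : ℂ) : (Fin 2 → ℂ) →L[ℝ] ℂ :=
  a • (ContinuousLinearMap.proj 0 : (Fin 2 → ℂ) →L[ℝ] ℂ)
    + b • (ContinuousLinearMap.proj 1 : (Fin 2 → ℂ) →L[ℝ] ℂ)
    + c • (conjCLE.toContinuousLinearMap ∘L (ContinuousLinearMap.proj 0 : (Fin 2 → ℂ) →L[ℝ] ℂ))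
    + d • (conjCLE.toContinuousLinearMap ∘L (ContinuousLinearMap.proj 1 : (Fin 2 → ℂ) →L[ℝ] ℂ))

@[simp] lemma wirtForm_apply (a b c d : ℂ) (v : Fin 2 → ℂ) :
    wirtForm a b c d v = a * v 0 + b * v 1 + c * conj (v 0) + d * conj (v 1) := by
  simp [wirtForm]

/-- `f` is real-differentiable at `p` with Wirtinger derivatives `∂f/∂z₀ = a`, `∂f/∂z₁ = b`,
`∂f/∂z̄₀ = c`, `∂f/∂z̄₁ = d`. -/
def HasWirt (f : (Fin 2 → ℂ) → ℂ) (a b c d : ℂ) (p : Fin 2 → ℂ) : Prop :=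
  HasFDerivAt f (wirtForm a b c d) p

namespace HasWirt

variable {f g : (Fin 2 → ℂ) → ℂ} {a b c d a' b' c' d' : ℂ} {p : Fin 2 → ℂ}

lemma dHol_zero (h : HasWirt f a b c d p) : dHol 0 f p = a := by
  rw [dHol, HasFDerivAt.fderiv h]
  simp
  linear_combination (-(a - c) / 2) * I_mul_I

lemma dHol_one (h : HasWirt f a b c d p) : dHol 1 f p = b := by
  rw [dHol, HasFDerivAt.fderiv h]
  simp
  linear_combination (-(b - d) / 2) * I_mul_I

lemma dAnti_zero (h : HasWirt f a b c d p) : dAnti 0 f p = c := by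
  rw [dAnti, HasFDerivAt.fderiv h]
  simp
  linear_combination ((a - c) / 2) * I_mul_I

lemma dAnti_one (h : HasWirt f a b c d p) : dAnti 1 f p = d := by
  rw [dAnti, HasFDerivAt.fderiv h]
  simp
  linear_combination ((b - d) / 2) * I_mul_I

lemma add (hf : HasWirt f a b c d p) (hg : HasWirt g a' b' c' d' p) :
    HasWirt (fun p => f p + g p) (a + a') (b + b') (c + c') (d + d') p := by
  refine (HasFDerivAt.add hf hg).congr_fderiv (ContinuousLinearMap.ext fun v => ?_)
  simp; ring

lemma mul (hf : HasWirt f a b c d p) (hg : HasWirt g a' b' c' d' p) :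
    HasWirt (fun p => f p * g p) (f p * a' + g p * a) (f p * b' + g p * b) (f p * c' + g p * c)
      (f p * d' + g p * d) p := by
  refine (HasFDerivAt.mul hf hg).congr_fderiv (ContinuousLinearMap.ext fun v => ?_)
  simp; ring

lemma star (hf : HasWirt f a b c d p) :
    HasWirt (fun p => conj (f p)) (conj c) (conj d) (conj a) (conj b) p := by
  refine ((conjCLE.toContinuousLinearMap.hasFDerivAt).comp p hf).congr_fderiv
    (ContinuousLinearMap.ext fun v => ?_)
  simp; ring

lemma inv (hf : HasWirt f a b c d p) (h0 : f p ≠ 0) :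
    HasWirt (fun p => (f p)⁻¹) (-a / f p ^ 2) (-b / f p ^ 2) (-c / f p ^ 2) (-d / f p ^ 2) p := by
  refine (((hasDerivAt_inv h0).hasFDerivAt.restrictScalars ℝ).comp p hf).congr_fderiv
    (ContinuousLinearMap.ext fun v => ?_)
  simp; ring

lemma congr (h : HasWirt f a b c d p) (ha : a = a') (hb : b = b') (hc : c = c') (hd : d = d') :
    HasWirt f a' b' c' d' p := by
  subst ha hb hc hd; exact h

lemma congr_of_eventuallyEq (h : HasWirt f a b c d p) (e : g =ᶠ[𝓝 p] f) : HasWirt g a b c d p :=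
  HasFDerivAt.congr_of_eventuallyEq h e

end HasWirt

lemma hasWirt_const (x : ℂ) (p : Fin 2 → ℂ) : HasWirt (fun _ => x) 0 0 0 0 p := by
  refine (hasFDerivAt_const x p).congr_fderiv (ContinuousLinearMap.ext fun v => ?_)
  simp

lemma hasWirt_zero (p : Fin 2 → ℂ) : HasWirt (fun p => p 0) 1 0 0 0 p := by
  refine (hasFDerivAt_apply 0 p).congr_fderiv (ContinuousLinearMap.ext fun v => ?_)
  simp

lemma hasWirt_one (p : Fin 2 → ℂ) : HasWirt (fun p => p 1) 0 1 0 0 p := by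
  refine (hasFDerivAt_apply 1 p).congr_fderiv (ContinuousLinearMap.ext fun v => ?_)
  simp

lemma exists_hasWirt_of_differentiableAt {f : (Fin 2 → ℂ) → ℂ} {p : Fin 2 → ℂ}
    (hf : DifferentiableAt ℂ f p) : ∃ a b, HasWirt f a b 0 0 p := by
  refine ⟨fderiv ℂ f p (Pi.single 0 1), fderiv ℂ f p (Pi.single 1 1), ?_⟩
  refine (hf.hasFDerivAt.restrictScalars ℝ).congr_fderiv (ContinuousLinearMap.ext fun v => ?_)
  have e : v = v 0 • Pi.single 0 1 + v 1 • Pi.single 1 1 := by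
    ext i; fin_cases i <;> simp
  rw [ContinuousLinearMap.coe_restrictScalars']
  conv_lhs => rw [e, map_add, map_smul, map_smul]
  simp [mul_comm]

lemma dHol_congr {f g : (Fin 2 → ℂ) → ℂ} {p : Fin 2 → ℂ} (h : f =ᶠ[𝓝 p] g) (α : Fin 2) :
    dHol α f p = dHol α g p := by
  rw [dHol, dHol, h.fderiv_eq]

lemma dAnti_congr {f g : (Fin 2 → ℂ) → ℂ} {p : Fin 2 → ℂ} (h : f =ᶠ[𝓝 p] g) (α : Fin 2) :
    dAnti α f p = dAnti α g p := by
  rw [dAnti, dAnti, h.fderiv_eq]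

lemma eventually_norm_one_lt {p : Fin 2 → ℂ} (hp : ‖p 1‖ < 1) : ∀ᶠ q in 𝓝 p, ‖q 1‖ < 1 := by
  have h : IsOpen {p : Fin 2 → ℂ | ‖p 1‖ < 1} := isOpen_lt (by fun_prop) continuous_const
  exact h.mem_nhds hp

/-! ## Expectation values in the coherent states -/

/-- `1 - |w|²`. -/
def diskDen (w : ℂ) : ℂ := 1 - w * conj w

/-- The expectation value of `a`. -/
def meanA (z w : ℂ) : ℂ := (z + w * conj z) / diskDen w

/-- The expectation value of `K_-`. -/
def meanKm (k : ℝ) (z w : ℂ) : ℂ := 2 * k * w / diskDen w + meanA z w ^ 2 / 2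

lemma diskDen_eq (w : ℂ) : diskDen w = ((1 - ‖w‖ ^ 2 : ℝ) : ℂ) := by
  rw [diskDen, mul_conj']; push_cast; rfl

lemma diskDen_ne_zero {w : ℂ} (hw : ‖w‖ < 1) : diskDen w ≠ 0 := by
  rw [diskDen_eq]
  have : 0 < 1 - ‖w‖ ^ 2 := by nlinarith [norm_nonneg w]
  exact_mod_cast this.ne'

lemma conj_diskDen (w : ℂ) : conj (diskDen w) = diskDen w := by
  rw [diskDen_eq, conj_ofReal]

lemma diskDen_conj (w : ℂ) : diskDen (conj w) = diskDen w := by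
  simp [diskDen, mul_comm]

lemma conj_meanA (z w : ℂ) : conj (meanA z w) = (conj z + conj w * z) / diskDen w := by
  simp [meanA, conj_diskDen]

lemma conj_meanKm (k : ℝ) (z w : ℂ) :
    conj (meanKm k z w) = 2 * k * conj w / diskDen w + conj (meanA z w) ^ 2 / 2 := by
  simp only [meanKm, map_add, map_div₀, map_mul, map_pow, conj_diskDen, conj_ofReal, conj_ofNat]

lemma meanA_conj (z w : ℂ) : meanA (conj z) (conj w) = conj (meanA z w) := by
  simp [meanA, conj_diskDen, diskDen_conj]

lemma meanKm_conj (k : ℝ) (z w : ℂ) : meanKm k (conj z) (conj w) = conj (meanKm k z w) := by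
  rw [conj_meanKm, meanKm, meanA_conj, diskDen_conj]

/-- The covariant symbol of a linear Hamiltonian. -/
def symbForm (k : ℝ) (ca cd c0 cp cm z w : ℂ) : ℂ :=
  fieldOne k ca c0 cm z w + fieldZ ca cd c0 cm z w * conj (meanA z w)
    + fieldW c0 cp cm w * conj (meanKm k z w)

lemma eq_meanA_sub {w : ℂ} (hw : ‖w‖ < 1) (z : ℂ) :
    z = meanA z w - w * conj (meanA z w) := by
  have h := diskDen_ne_zero hw
  rw [conj_meanA, meanA]
  field_simp
  rw [diskDen]; ring

/-- The form of the symbol in which its symmetries are visible: the expectation values of `a†`,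
`K_+` are conjugate to those of `a`, `K_-`, and that of `K_0` is real. -/
lemma symbForm_eq (k : ℝ) (ca cd c0 cp cm z : ℂ) {w : ℂ} (hw : ‖w‖ < 1) :
    symbForm k ca cd c0 cp cm z w = ca * meanA z w + cd * conj (meanA z w)
      + c0 * (k * (1 + w * conj w) / diskDen w + meanA z w * conj (meanA z w) / 2)
      + cp * conj (meanKm k z w) + cm * meanKm k z w := by
  have h := diskDen_ne_zero hw
  have hz := eq_meanA_sub hw z
  rw [symbForm, fieldOne, fieldZ, fieldW, conj_meanKm, meanKm]
  generalize meanA z w = x at *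
  subst hz
  generalize conj x = y
  field_simp
  rw [diskDen]
  ring

/-- The exchange of `H` and `H̃` in the holomorphic realization. -/
lemma symbForm_conj (k : ℝ) (ca cd c0 cp cm z : ℂ) {w : ℂ} (hw : ‖w‖ < 1) :
    symbForm k ca cd c0 cp cm (conj z) (conj w) = symbForm k cd ca c0 cm cp z w := by
  rw [symbForm_eq _ _ _ _ _ _ _ hw, symbForm_eq _ _ _ _ _ _ _ (by rwa [norm_conj]), meanKm_conj,
    meanA_conj, diskDen_conj, conj_conj, conj_conj, conj_conj]
  ring

lemma conj_symbForm (k : ℝ) (ca cd c0 cp cm z : ℂ) {w : ℂ} (hw : ‖w‖ < 1) :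
    conj (symbForm k ca cd c0 cp cm z w)
      = symbForm k (conj cd) (conj ca) (conj c0) (conj cm) (conj cp) z w := by
  rw [symbForm_eq _ _ _ _ _ _ _ hw, symbForm_eq _ _ _ _ _ _ _ hw]
  simp only [map_add, map_mul, map_div₀, conj_conj, conj_diskDen, conj_ofReal, map_one, conj_ofNat]
  ring

section Expectation
variable {k : ℝ} (hk : 1 / 4 < k) (z : ℂ) {w : ℂ} (hw : ‖w‖ < 1)
include hk hw

lemma opKm_coh_mem_geomDecay : opKm k (coh k z w) ∈ geomDecay := by
  have h := coh_mem_geomDecay k z hw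
  rw [opKm_coh hk]
  exact geomDecay.add_mem (geomDecay.add_mem (geomDecay.smul_mem _ h)
    (geomDecay.smul_mem _ (opAd_mem_geomDecay h))) (geomDecay.smul_mem _ (opKp_mem_geomDecay k h))

omit hk in
-- With `X = ⟨e, a† e⟩` and `N = ⟨e, e⟩`, adjointness gives `X̄ = z N + w X`. This and its conjugate
-- form a linear system of determinant `1 - |w|²`.
lemma conj_braket_opAd : conj (braket (coh k z w) (opAd (coh k z w)))
    = meanA z w * braket (coh k z w) (coh k z w) := by
  have h := coh_mem_geomDecay k z hw
  have h1 : conj (braket (coh k z w) (opAd (coh k z w)))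
      = z * braket (coh k z w) (coh k z w) + w * braket (coh k z w) (opAd (coh k z w)) := by
    rw [conj_braket, braket_opAd, opA_coh, braket_add_right h (geomDecay.smul_mem _ h)
      (geomDecay.smul_mem _ (opAd_mem_geomDecay h)), braket_smul_right, braket_smul_right]
  have h2 := congrArg conj h1
  simp only [map_add, map_mul, conj_conj, conj_braket (coh k z w) (coh k z w)] at h2
  have h0 := diskDen_ne_zero hw
  rw [meanA, div_mul_eq_mul_div, eq_div_iff h0, diskDen]
  linear_combination h1 + w * h2

omit hk in
lemma braket_opAd_eq : braket (coh k z w) (opAd (coh k z w))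
    = conj (meanA z w) * braket (coh k z w) (coh k z w) := by
  have h := congrArg conj (conj_braket_opAd (k := k) z hw)
  rwa [conj_conj, map_mul, conj_braket] at h

lemma conj_braket_opKp : conj (braket (coh k z w) (opKp k (coh k z w)))
    = meanKm k z w * braket (coh k z w) (coh k z w) := by
  have h := coh_mem_geomDecay k z hw
  have h1 : conj (braket (coh k z w) (opKp k (coh k z w)))
      = (z ^ 2 / 2 + 2 * k * w) * braket (coh k z w) (coh k z w)
        + z * w * braket (coh k z w) (opAd (coh k z w))
        + w ^ 2 * braket (coh k z w) (opKp k (coh k z w)) := by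
    rw [conj_braket, braket_opKp h h (opKm_coh_mem_geomDecay hk z hw), opKm_coh hk,
      braket_add_right h (geomDecay.add_mem (geomDecay.smul_mem _ h)
        (geomDecay.smul_mem _ (opAd_mem_geomDecay h)))
        (geomDecay.smul_mem _ (opKp_mem_geomDecay k h)),
      braket_add_right h (geomDecay.smul_mem _ h)
        (geomDecay.smul_mem _ (opAd_mem_geomDecay h)), braket_smul_right, braket_smul_right,
      braket_smul_right]
  rw [braket_opAd_eq z hw] at h1
  have h2 := congrArg conj h1
  simp only [map_add, map_mul, map_pow, map_div₀, conj_conj, conj_braket (coh k z w) (coh k z w),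
    conj_ofReal, conj_ofNat] at h2
  have h0 := diskDen_ne_zero hw
  -- The determinant `1 - |w|⁴` of the analogous system for `⟨e, K_+ e⟩` and its conjugate.
  have h3 : 1 - w ^ 2 * conj w ^ 2 ≠ 0 := by
    have e : 1 - w ^ 2 * conj w ^ 2 = ((1 - ‖w‖ ^ 2 : ℝ) : ℂ) * ((1 + ‖w‖ ^ 2 : ℝ) : ℂ) := by
      rw [← mul_pow, mul_conj']; push_cast; ring
    rw [e, ← diskDen_eq]
    have : 0 < 1 + ‖w‖ ^ 2 := by positivity
    exact mul_ne_zero h0 (by exact_mod_cast this.ne')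
  have hz := eq_meanA_sub hw z
  have hz' := congrArg conj hz
  simp only [map_sub, map_mul, conj_conj] at hz'
  refine mul_left_cancel₀ h3 ?_
  have e1 : (1 - w ^ 2 * conj w ^ 2) * conj (braket (coh k z w) (opKp k (coh k z w)))
    = ((z ^ 2 / 2 + 2 * k * w) + z * w * conj (meanA z w) + w ^ 2 * (
      (conj z ^ 2 / 2 + 2 * k * conj w) + conj z * conj w * meanA z w))
        * braket (coh k z w) (coh k z w) := by
    linear_combination h1 + w ^ 2 * h2
  rw [e1, ← mul_assoc]
  congr 1
  rw [hz', meanKm]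
  generalize meanA z w = x at *
  subst hz
  generalize conj x = y
  field_simp
  rw [diskDen]
  ring

lemma braket_opKp_eq : braket (coh k z w) (opKp k (coh k z w))
    = conj (meanKm k z w) * braket (coh k z w) (coh k z w) := by
  have h := congrArg conj (conj_braket_opKp hk z hw)
  rwa [conj_conj, map_mul, conj_braket] at h

omit hk hw in
lemma coh_zero_zero : coh k z w (0, 0) = 1 := by
  simp [coh_eq_cohCoeff, cohCoeff, hermiteTwo, suRadial]

omit hk in
lemma braket_coh_eq : braket (coh k z w) (coh k z w) = ((‖cohHilb k ![z, w]‖ ^ 2 : ℝ) : ℂ) := by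
  have h := braket_eq_inner (cohHilb k ![z, w]) (cohHilb k ![z, w])
  rw [coe_cohHilb (p := ![z, w]) (by simpa using hw)] at h
  rw [inner_self_eq_norm_sq_to_K] at h
  exact h.trans (by push_cast; rfl)

omit hk in
lemma norm_cohHilb_pos : 0 < ‖cohHilb k ![z, w]‖ := by
  rw [norm_pos_iff]
  intro h0
  have h := coe_cohHilb (k := k) (p := ![z, w]) (by simpa using hw)
  have h2 := coh_zero_zero (k := k) z (w := w)
  rw [h0] at h
  have h3 := congrFun h (0, 0)
  simp [h2] at h3

omit hk in
lemma braket_coh_ne_zero : braket (coh k z w) (coh k z w) ≠ 0 := by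
  rw [braket_coh_eq z hw]
  have := norm_cohHilb_pos (k := k) z hw
  exact_mod_cast (by positivity : ‖cohHilb k ![z, w]‖ ^ 2 ≠ 0)

lemma symb_linHam (ca cd c0 cp cm : ℂ) :
    symb (linHam k ca cd c0 cp cm) (coh k z w) = symbForm k ca cd c0 cp cm z w := by
  have h := coh_mem_geomDecay k z hw
  rw [symb, div_eq_iff (braket_coh_ne_zero z hw), linHam_coh hk,
      braket_add_right h (geomDecay.add_mem (geomDecay.smul_mem _ h)
        (geomDecay.smul_mem _ (opAd_mem_geomDecay h)))
        (geomDecay.smul_mem _ (opKp_mem_geomDecay k h)),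
      braket_add_right h (geomDecay.smul_mem _ h)
        (geomDecay.smul_mem _ (opAd_mem_geomDecay h)), braket_smul_right, braket_smul_right,
      braket_smul_right, braket_opAd_eq z hw, braket_opKp_eq hk z hw, symbForm]
  ring

end Expectation

/-! ## The Kähler metric -/

/-- Since `e` is holomorphic, `∂_z log ⟨e, e⟩ = ⟨e, a† e⟩ / ⟨e, e⟩`, and likewise `∂_w` gives the
mean of `K_+`; the potential is real, so the other two derivatives are conjugate. -/
lemma hasWirt_kahlerPot {k : ℝ} (hk : 1 / 4 < k) {p : Fin 2 → ℂ} (hp : ‖p 1‖ < 1) :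
    HasWirt (kahlerPot k) (conj (meanA (p 0) (p 1))) (conj (meanKm k (p 0) (p 1)))
      (meanA (p 0) (p 1)) (meanKm k (p 0) (p 1)) p := by
  have hE : HasFDerivAt (cohHilb k)
      ((formHilb (cohHilbZ k p) (cohHilbW k p)).restrictScalars ℝ) p :=
    (hasFDerivAt_cohHilb k hp).restrictScalars ℝ
  have hG := HasFDerivAt.inner ℂ hE hE
  have hF : braket (coh k (p 0) (p 1)) (coh k (p 0) (p 1)) = inner ℂ (cohHilb k p) (cohHilb k p) := by
    rw [← braket_eq_inner, coe_cohHilb hp]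
  have hpos : 0 < (inner ℂ (cohHilb k p) (cohHilb k p) : ℂ).re := by
    rw [← hF, braket_coh_eq _ hp, ofReal_re]
    have := norm_cohHilb_pos (k := k) (p 0) hp
    positivity
  have hre : (((inner ℂ (cohHilb k p) (cohHilb k p) : ℂ).re : ℝ) : ℂ)
      = inner ℂ (cohHilb k p) (cohHilb k p) := by
    rw [← hF, braket_coh_eq _ hp, ofReal_re]
  have hlog := (ofRealCLM.hasFDerivAt.comp p
    (((reCLM.hasFDerivAt.comp p hG)).log hpos.ne'))
  have hZ : inner ℂ (cohHilb k p) (cohHilbZ k p)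
      = conj (meanA (p 0) (p 1)) * inner ℂ (cohHilb k p) (cohHilb k p) := by
    rw [← hF, ← braket_opAd_eq _ hp, ← braket_eq_inner, coe_cohHilb hp, coe_cohHilbZ hp]
  have hW : inner ℂ (cohHilb k p) (cohHilbW k p)
      = conj (meanKm k (p 0) (p 1)) * inner ℂ (cohHilb k p) (cohHilb k p) := by
    rw [← hF, ← braket_opKp_eq hk _ hp, ← braket_eq_inner, coe_cohHilb hp, coe_cohHilbW hp]
  refine HasFDerivAt.congr_of_eventuallyEq (hlog.congr_fderiv (ContinuousLinearMap.ext fun v => ?_))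
    (f := _) ?_
  · simp only [ContinuousLinearMap.comp_apply, fderivInnerCLM_apply, ContinuousLinearMap.prod_apply,
      ContinuousLinearMap.coe_restrictScalars', formHilb_apply, inner_add_right, inner_add_left,
      inner_smul_left, inner_smul_right, ofRealCLM_apply, reCLM_apply, smul_apply, smul_eq_mul]
    rw [← inner_conj_symm (cohHilbZ k p), ← inner_conj_symm (cohHilbW k p), hZ, hW]
    simp only [Function.comp_apply, reCLM_apply]
    have hne : ((inner ℂ (cohHilb k p) (cohHilb k p) : ℂ).re : ℂ) ≠ 0 := by exact_mod_cast hpos.ne'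
    rw [← hre]
    generalize (inner ℂ (cohHilb k p) (cohHilb k p) : ℂ).re = r at *
    rw [ofReal_mul, re_eq_add_conj, ofReal_inv, wirtForm_apply]
    simp only [map_add, map_mul, conj_conj, conj_ofReal]
    field_simp
    ring
  · filter_upwards [eventually_norm_one_lt hp] with q hq
    simp only [kahlerPot, Function.comp_apply, ofRealCLM_apply, reCLM_apply]
    rw [← coe_cohHilb hq, braket_eq_inner]

lemma hasWirt_diskDen (p : Fin 2 → ℂ) :
    HasWirt (fun p => diskDen (p 1)) 0 (-conj (p 1)) 0 (-p 1) p :=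
  ((hasWirt_const 1 p).add ((hasWirt_const (-1) p).mul
    ((hasWirt_one p).mul (hasWirt_one p).star))).congr_of_eventuallyEq
      (Eventually.of_forall fun p => by simp [diskDen, sub_eq_add_neg]) |>.congr
      (by simp) (by simp) (by simp) (by simp)

lemma hasWirt_meanA {p : Fin 2 → ℂ} (hp : ‖p 1‖ < 1) :
    HasWirt (fun p => meanA (p 0) (p 1)) (1 / diskDen (p 1))
      (conj (meanA (p 0) (p 1)) / diskDen (p 1)) (p 1 / diskDen (p 1))
      (meanA (p 0) (p 1) * p 1 / diskDen (p 1)) p := by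
  have h0 := diskDen_ne_zero hp
  refine (((hasWirt_zero p).add ((hasWirt_one p).mul (hasWirt_zero p).star)).mul
    ((hasWirt_diskDen p).inv h0)).congr_of_eventuallyEq
      (Eventually.of_forall fun p => by simp [meanA, div_eq_mul_inv]) |>.congr ?_ ?_ ?_ ?_
  · simp
  · rw [conj_meanA]
    simp only [map_zero, mul_zero, mul_one, zero_add]
    field_simp
    rw [diskDen]; ring
  · simp only [map_one, mul_one, mul_zero, zero_add, add_zero, neg_zero, zero_div]
    field_simp
  · rw [meanA]
    simp only [map_zero, mul_zero, add_zero]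
    field_simp

/-- Only the holomorphic derivatives are made explicit: they are the entries of `g`, and conjugation
turns them into the antiholomorphic derivatives of the mean of `K_+`. -/
lemma hasWirt_meanKm (k : ℝ) {p : Fin 2 → ℂ} (hp : ‖p 1‖ < 1) :
    ∃ c d, HasWirt (fun p => meanKm k (p 0) (p 1)) (meanA (p 0) (p 1) / diskDen (p 1))
      (2 * k / diskDen (p 1) ^ 2 + meanA (p 0) (p 1) * conj (meanA (p 0) (p 1)) / diskDen (p 1))
      c d p := by
  have h0 := diskDen_ne_zero hp
  have hA := hasWirt_meanA hp
  refine ⟨_, _, (((hasWirt_const (2 * k) p).mul (hasWirt_one p)).mul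
    ((hasWirt_diskDen p).inv h0)).add ((hasWirt_const (1 / 2) p).mul (hA.mul hA))
    |>.congr_of_eventuallyEq
      (Eventually.of_forall fun p => by simp only [meanKm]; ring) |>.congr ?_ ?_ rfl rfl⟩
  · simp only [mul_zero, zero_add, add_zero, neg_zero, zero_div]
    field_simp
    ring
  · simp only [mul_zero, add_zero, mul_one]
    field_simp
    rw [diskDen]; ring

/-- The closed form of the Kähler metric of the Siegel-Jacobi disk. -/
def metricForm (k : ℝ) (z w : ℂ) : Matrix (Fin 2) (Fin 2) ℂ :=
  !![1 / diskDen w, meanA z w / diskDen w;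
    conj (meanA z w) / diskDen w,
    2 * k / diskDen w ^ 2 + meanA z w * conj (meanA z w) / diskDen w]

lemma metric_eq {k : ℝ} (hk : 1 / 4 < k) {p : Fin 2 → ℂ} (hp : ‖p 1‖ < 1) :
    metric k p = metricForm k (p 0) (p 1) := by
  have h0 : dAnti 0 (kahlerPot k) =ᶠ[𝓝 p] fun p => meanA (p 0) (p 1) := by
    filter_upwards [eventually_norm_one_lt hp] with q hq
    exact (hasWirt_kahlerPot hk hq).dAnti_zero
  have h1 : dAnti 1 (kahlerPot k) =ᶠ[𝓝 p] fun p => meanKm k (p 0) (p 1) := by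
    filter_upwards [eventually_norm_one_lt hp] with q hq
    exact (hasWirt_kahlerPot hk hq).dAnti_one
  obtain ⟨c, d, hK⟩ := hasWirt_meanKm k hp
  have hA := hasWirt_meanA hp
  ext α β
  fin_cases α <;> fin_cases β
  · exact (dHol_congr h0 0).trans hA.dHol_zero
  · exact (dHol_congr h1 0).trans hK.dHol_zero
  · exact (dHol_congr h0 1).trans hA.dHol_one
  · exact (dHol_congr h1 1).trans hK.dHol_one

lemma det_metricForm_ne_zero {k : ℝ} (hk : k ≠ 0) (z : ℂ) {w : ℂ} (hw : ‖w‖ < 1) :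
    (metricForm k z w).det ≠ 0 := by
  have h0 := diskDen_ne_zero hw
  have e : (metricForm k z w).det = 2 * k / diskDen w ^ 3 := by
    rw [metricForm, Matrix.det_fin_two_of]
    field_simp
    ring
  rw [e]
  have : (k : ℂ) ≠ 0 := by exact_mod_cast hk
  exact div_ne_zero (mul_ne_zero two_ne_zero this) (pow_ne_zero _ h0)

/-- The antiholomorphic differential of the symbol of a linear Hamiltonian. -/
lemma dAnti_symbForm (k : ℝ) (ca cd c0 cp cm : ℂ) {p : Fin 2 → ℂ} (hp : ‖p 1‖ < 1) (β : Fin 2) :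
    dAnti β (fun p => symbForm k ca cd c0 cp cm (p 0) (p 1)) p
      = Matrix.vecMul ![fieldZ ca cd c0 cm (p 0) (p 1), fieldW c0 cp cm (p 1)]
        (metricForm k (p 0) (p 1)) β := by
  obtain ⟨c, d, hK⟩ := hasWirt_meanKm k hp
  have hA := hasWirt_meanA hp
  obtain ⟨a1, b1, h1⟩ := exists_hasWirt_of_differentiableAt (p := p)
    (f := fun p => fieldOne k ca c0 cm (p 0) (p 1)) (by unfold fieldOne; fun_prop)
  obtain ⟨a2, b2, h2⟩ := exists_hasWirt_of_differentiableAt (p := p)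
    (f := fun p => fieldZ ca cd c0 cm (p 0) (p 1)) (by unfold fieldZ; fun_prop)
  obtain ⟨a3, b3, h3⟩ := exists_hasWirt_of_differentiableAt (p := p)
    (f := fun p => fieldW c0 cp cm (p 1)) (by unfold fieldW; fun_prop)
  have h := (h1.add (h2.mul hA.star)).add (h3.mul hK.star)
  fin_cases β
  · refine h.dAnti_zero.trans ?_
    simp [metricForm, Matrix.vecMul, dotProduct, conj_diskDen]
  · refine h.dAnti_one.trans ?_
    simp [metricForm, Matrix.vecMul, dotProduct, conj_diskDen, conj_ofNat, mul_comm]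

/-- A coordinate has zero antiholomorphic derivatives, so the bracket is `-∑ β, dAnti β f * g⁻¹ β
γ`. With `dAnti f = A g` this collapses to `-A γ`. -/
lemma poisson_symbForm {k : ℝ} (hk : 1 / 4 < k) (ca cd c0 cp cm : ℂ) {p : Fin 2 → ℂ}
    (hp : ‖p 1‖ < 1) {f : (Fin 2 → ℂ) → ℂ}
    (hf : ∀ p : Fin 2 → ℂ, ‖p 1‖ < 1 → f p = symbForm k ca cd c0 cp cm (p 0) (p 1)) :
    poisson k f (fun p => p 0) p = -fieldZ ca cd c0 cm (p 0) (p 1) ∧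
    poisson k f (fun p => p 1) p = -fieldW c0 cp cm (p 1) := by
  have hfe : f =ᶠ[𝓝 p] fun p => symbForm k ca cd c0 cp cm (p 0) (p 1) := by
    filter_upwards [eventually_norm_one_lt hp] with q hq
    exact hf q hq
  set A : Fin 2 → ℂ := ![fieldZ ca cd c0 cm (p 0) (p 1), fieldW c0 cp cm (p 1)] with hA
  set g := metricForm k (p 0) (p 1) with hg
  have hd : ∀ β, dAnti β f p = Matrix.vecMul A g β := fun β =>
    (dAnti_congr hfe β).trans (dAnti_symbForm k ca cd c0 cp cm hp β)
  have hinv : ∀ γ, ∑ β, Matrix.vecMul A g β * g⁻¹ β γ = A γ := fun γ => by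
    change Matrix.vecMul (Matrix.vecMul A g) g⁻¹ γ = A γ
    rw [Matrix.vecMul_vecMul, Matrix.mul_nonsing_inv _
      (isUnit_iff_ne_zero.2 (det_metricForm_ne_zero (by linarith) _ hp)), Matrix.vecMul_one]
  have c0 := hasWirt_zero p
  have c1 := hasWirt_one p
  constructor
  · have h := hinv 0
    simp only [poisson, metric_eq hk hp, hd, Fin.sum_univ_two, c0.dAnti_zero, c0.dAnti_one,
      c0.dHol_zero, c0.dHol_one, ← hg] at h ⊢
    rw [show fieldZ ca cd _ cm (p 0) (p 1) = A 0 from rfl, ← h]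
    ring
  · have h := hinv 1
    simp only [poisson, metric_eq hk hp, hd, Fin.sum_univ_two, c1.dAnti_zero, c1.dAnti_one,
      c1.dHol_zero, c1.dHol_one, ← hg] at h ⊢
    rw [show fieldW _ cp cm (p 1) = A 1 from rfl, ← h]
    ring

/-- Classical motion for a linear Hamiltonian, in explicit form. -/
theorem classicalMotion_iff {k : ℝ} (hk : 1 / 4 < k) {ca cd c0 cp cm : ℝ → ℂ} {J : Set ℝ}
    {z w : ℝ → ℂ} (hw : ∀ t ∈ J, ‖w t‖ < 1) {E : ℝ → (Fin 2 → ℂ) → ℂ}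
    (hE : ∀ t, ∀ p : Fin 2 → ℂ, ‖p 1‖ < 1 →
      E t p = symbForm k (ca t) (cd t) (c0 t) (cp t) (cm t) (p 0) (p 1)) :
    ClassicalMotion k E J z w ↔ ∀ t ∈ J, DifferentiableAt ℝ z t ∧ DifferentiableAt ℝ w t ∧
      I * deriv z t = fieldZ (ca t) (cd t) (c0 t) (cm t) (z t) (w t) ∧
      I * deriv w t = fieldW (c0 t) (cp t) (cm t) (w t) := by
  have hI : ∀ a b : ℂ, a = I * -b ↔ I * a = b := fun a b => by
    constructor <;> intro h
    · rw [h]; linear_combination (-b) * I_mul_I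
    · rw [← h]; linear_combination a * I_mul_I
  refine forall₂_congr fun t ht => ?_
  have h := poisson_symbForm hk (ca t) (cd t) (c0 t) (cp t) (cm t) (p := ![z t, w t])
    (by simpa using hw t ht) (hE t)
  rw [h.1, h.2, hI, hI]
  rfl

/-! ## Changes of variables in the equations of motion -/

lemma add_I_ne_zero {v : ℂ} (hv : 0 < v.im) : v + I ≠ 0 := by
  intro h
  have := congrArg im h
  simp at this
  linarith

lemma one_sub_cayleyW {v : ℂ} (hv : 0 < v.im) : 1 - cayleyW v = 2 * I / (v + I) := by
  have h := add_I_ne_zero hv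
  rw [cayleyW]; field_simp; ring

lemma norm_cayleyW_lt_one {v : ℂ} (hv : 0 < v.im) : ‖cayleyW v‖ < 1 := by
  have h := add_I_ne_zero hv
  rw [cayleyW, norm_div, div_lt_one (norm_pos_iff.2 h), ← sq_lt_sq₀ (norm_nonneg _) (norm_nonneg _),
    ← normSq_eq_norm_sq, ← normSq_eq_norm_sq, normSq_apply, normSq_apply]
  simp
  nlinarith

lemma hasDerivAt_cayleyW {v : ℝ → ℂ} {t : ℝ} (hv : 0 < (v t).im) (hd : DifferentiableAt ℝ v t) :
    HasDerivAt (fun t => cayleyW (v t)) (2 * I * deriv v t / (v t + I) ^ 2) t := by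
  have h := add_I_ne_zero hv
  refine ((hd.hasDerivAt.sub_const I).div (hd.hasDerivAt.add_const I) h).congr_deriv ?_
  field_simp; ring

lemma hasDerivAt_cayleyZ {v u : ℝ → ℂ} {t : ℝ} (hv : 0 < (v t).im) (hd : DifferentiableAt ℝ v t)
    (hu : DifferentiableAt ℝ u t) :
    HasDerivAt (fun t => cayleyZ (v t) (u t))
      (2 * I * deriv u t / (v t + I) - 2 * I * u t * deriv v t / (v t + I) ^ 2) t := by
  have h := add_I_ne_zero hv
  refine ((hu.hasDerivAt.const_mul (2 * I)).div (hd.hasDerivAt.add_const I) h).congr_deriv ?_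
  field_simp

lemma differentiableAt_cayleyW_iff {J : Set ℝ} (hJ : IsOpen J) {v : ℝ → ℂ}
    (hv : ∀ t ∈ J, 0 < (v t).im) {t : ℝ} (ht : t ∈ J) :
    DifferentiableAt ℝ (fun t => cayleyW (v t)) t ↔ DifferentiableAt ℝ v t := by
  refine ⟨fun h => ?_, fun h => (hasDerivAt_cayleyW (hv t ht) h).differentiableAt⟩
  have h1 : 1 - cayleyW (v t) ≠ 0 := by
    rw [one_sub_cayleyW (hv t ht)]
    exact div_ne_zero (by simp) (add_I_ne_zero (hv t ht))
  have h2 : DifferentiableAt ℝ (fun t => I * (1 + cayleyW (v t)) / (1 - cayleyW (v t))) t :=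
    ((h.const_add 1).const_mul I).div (h.const_sub 1) h1
  refine h2.congr_of_eventuallyEq ?_
  filter_upwards [hJ.mem_nhds ht] with s hs
  have h3 := add_I_ne_zero (hv s hs)
  rw [one_sub_cayleyW (hv s hs), cayleyW]
  field_simp
  ring

lemma differentiableAt_cayleyZ_iff {J : Set ℝ} (hJ : IsOpen J) {v u : ℝ → ℂ}
    (hv : ∀ t ∈ J, 0 < (v t).im) {t : ℝ} (ht : t ∈ J) (hd : DifferentiableAt ℝ v t) :
    DifferentiableAt ℝ (fun t => cayleyZ (v t) (u t)) t ↔ DifferentiableAt ℝ u t := by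
  refine ⟨fun h => ?_, fun h => (hasDerivAt_cayleyZ (hv t ht) hd h).differentiableAt⟩
  have h2 : DifferentiableAt ℝ (fun t => cayleyZ (v t) (u t) * (v t + I) / (2 * I)) t :=
    (h.mul (hd.add_const I)).div_const _
  refine h2.congr_of_eventuallyEq ?_
  filter_upwards [hJ.mem_nhds ht] with s hs
  have h3 := add_I_ne_zero (hv s hs)
  rw [cayleyZ]
  field_simp

/-- The Riccati equation under the Cayley transform. -/
lemma cayleyW_eq_iff {e0 ep em v v' : ℂ} (hv : 0 < v.im) :
    I * (2 * I * v' / (v + I) ^ 2) = em + e0 * cayleyW v + ep * cayleyW v ^ 2 ↔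
      -2 * v' = (e0 + ep + em) * v ^ 2 + 2 * I * (em - ep) * v + e0 - em - ep := by
  have h := add_I_ne_zero hv
  have e1 : I * (2 * I * v' / (v + I) ^ 2) = -2 * v' / (v + I) ^ 2 := by
    rw [← mul_div_assoc]; congr 1; linear_combination 2 * v' * I_mul_I
  have e2 : em + e0 * cayleyW v + ep * cayleyW v ^ 2
      = ((e0 + ep + em) * v ^ 2 + 2 * I * (em - ep) * v + e0 - em - ep) / (v + I) ^ 2 := by
    rw [cayleyW, eq_div_iff (pow_ne_zero 2 h)]
    field_simp
    linear_combination (em - e0 + ep) * I_mul_I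
  rw [e1, e2, div_left_inj' (pow_ne_zero 2 h)]

/-- The derivative of `z` involves `v'`, so the Riccati equation is used to eliminate it before the
`u` equation can be isolated. -/
lemma cayleyZ_eq_iff {ea eb e0 ep em v u v' u' : ℂ} (hv : 0 < v.im)
    (hvv : -2 * v' = (e0 + ep + em) * v ^ 2 + 2 * I * (em - ep) * v + e0 - em - ep) :
    I * (2 * I * u' / (v + I) - 2 * I * u * v' / (v + I) ^ 2)
        = ea + eb * cayleyW v + (e0 / 2 + ep * cayleyW v) * cayleyZ v u ↔
      -2 * u' = (ea + eb) * v + I * (ea - eb) + ((e0 + ep + em) * v + I * (em - ep)) * u := by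
  have h := add_I_ne_zero hv
  have e1 : I * (2 * I * u' / (v + I) - 2 * I * u * v' / (v + I) ^ 2)
      = (-2 * u' * (v + I) - u * (-2 * v')) / (v + I) ^ 2 := by
    rw [eq_div_iff (pow_ne_zero 2 h)]
    field_simp
    linear_combination (u' * (v + I) - u * v') * I_mul_I
  have e2 : ea + eb * cayleyW v + (e0 / 2 + ep * cayleyW v) * cayleyZ v u
      = (((ea + eb) * v + I * (ea - eb) + ((e0 + ep + em) * v + I * (em - ep)) * u) * (v + I)
        - u * ((e0 + ep + em) * v ^ 2 + 2 * I * (em - ep) * v + e0 - em - ep)) / (v + I) ^ 2 := by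
    rw [eq_div_iff (pow_ne_zero 2 h), cayleyW, cayleyZ]
    field_simp
    ring_nf
    simp only [I_sq]
    ring
  rw [e1, e2, div_left_inj' (pow_ne_zero 2 h), hvv, sub_left_inj, mul_left_inj' h]

theorem diskEq_cayley_iff {εa ε0 εp εm : ℝ → ℂ} {J : Set ℝ} (hJ : IsOpen J) {v u : ℝ → ℂ}
    (hv : ∀ t ∈ J, 0 < (v t).im) :
    DiskEq εa ε0 εp εm J (fun t => cayleyZ (v t) (u t)) (fun t => cayleyW (v t)) ↔
      HalfPlaneEq εa ε0 εp εm J v u := by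
  refine forall₂_congr fun t ht => ?_
  rw [differentiableAt_cayleyW_iff hJ hv ht, and_left_comm]
  refine and_congr_right fun hd => ?_
  rw [differentiableAt_cayleyZ_iff hJ hv ht hd]
  refine and_congr_right fun hu => ?_
  rw [(hasDerivAt_cayleyW (hv t ht) hd).deriv, (hasDerivAt_cayleyZ (hv t ht) hd hu).deriv,
    cayleyW_eq_iff (hv t ht), and_comm]
  exact and_congr_right fun h => cayleyZ_eq_iff (hv t ht) h

/-! ## Decoupling -/

lemma etaDisk_eq_meanA (z w : ℂ) : etaDisk z w = meanA z w := by
  rw [etaDisk, meanA, diskDen_eq]; push_cast; rfl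

lemma eq_zero_of_add_mul_conj {x w : ℂ} (hw : ‖w‖ < 1) (h : x + w * conj x = 0) : x = 0 := by
  have h1 : x = -(w * conj x) := eq_neg_of_add_eq_zero_left h
  have h2 : ‖x‖ = ‖w‖ * ‖x‖ := by
    conv_lhs => rw [h1]
    rw [norm_neg, norm_mul, norm_conj]
  by_contra hx
  have := norm_pos_iff.2 hx
  nlinarith

theorem diskEq_iff_decoupledDiskEq {εa ε0 εp εm : ℝ → ℂ} {J : Set ℝ} (hJ : IsOpen J)
    (hpm : ∀ t ∈ J, conj (εp t) = εm t) (h0 : ∀ t ∈ J, conj (ε0 t) = ε0 t) {z w : ℝ → ℂ}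
    (hw : ∀ t ∈ J, ‖w t‖ < 1) :
    DiskEq εa ε0 εp εm J z w ↔
      DecoupledDiskEq εa ε0 εp εm J (fun t => etaDisk (z t) (w t)) w := by
  simp only [etaDisk_eq_meanA]
  refine forall₂_congr fun t ht => ?_
  rw [and_left_comm, and_left_comm (b := DifferentiableAt ℝ w t)]
  refine and_congr_right fun hdw => ?_
  have hcw : HasDerivAt (fun t => conj (w t)) (conj (deriv w t)) t := hdw.hasDerivAt.star
  have hz : z =ᶠ[𝓝 t] fun t => meanA (z t) (w t) - w t * conj (meanA (z t) (w t)) := by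
    filter_upwards [hJ.mem_nhds ht] with s hs
    exact eq_meanA_sub (hw s hs) _
  have hzt : z t = meanA (z t) (w t) - w t * conj (meanA (z t) (w t)) := hz.eq_of_nhds
  have hdiff : DifferentiableAt ℝ z t ↔ DifferentiableAt ℝ (fun t => meanA (z t) (w t)) t := by
    constructor
    · intro hd
      have hcz : HasDerivAt (fun t => conj (z t)) (conj (deriv z t)) t := hd.hasDerivAt.star
      exact (hd.add (hdw.mul hcz.differentiableAt)).div
        ((hdw.mul hcw.differentiableAt).const_sub 1) (diskDen_ne_zero (hw t ht))
    · intro hd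
      have hcz : HasDerivAt (fun t => conj (meanA (z t) (w t)))
        (conj (deriv (fun t => meanA (z t) (w t)) t)) t := hd.hasDerivAt.star
      exact (hd.sub (hdw.mul hcz.differentiableAt)).congr_of_eventuallyEq hz
  rw [hdiff]
  refine and_congr_right fun hdη => ?_
  rw [and_comm, and_comm (b := I * deriv w t = _)]
  refine and_congr_right fun hweq => ?_
  set η' := deriv (fun t => meanA (z t) (w t)) t with hη'
  have hcη : HasDerivAt (fun t => conj (meanA (z t) (w t))) (conj η') t := hdη.hasDerivAt.star
  have hz' : deriv z t = η' - (deriv w t * conj (meanA (z t) (w t)) + w t * conj η') := by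
    rw [hz.deriv_eq]
    exact (hdη.hasDerivAt.sub (hdw.hasDerivAt.mul hcη)).deriv
  rw [hz', hzt]
  have hA : meanA (meanA (z t) (w t) - w t * conj (meanA (z t) (w t))) (w t)
      = meanA (z t) (w t) := by rw [← hzt]
  rw [hA]
  beta_reduce
  generalize meanA (z t) (w t) = η at *
  have hm : conj (εm t) = εp t := by rw [← hpm t ht, conj_conj]
  -- The residual of the `z` equation is `R + w R̄`, with `R` that of the `η` equation; the Riccati
  -- equation and the hermiticity of the coefficients enter here.
  have key : I * (η' - (deriv w t * conj η + w t * conj η'))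
      - (εa t + conj (εa t) * w t + (ε0 t / 2 + εp t * w t) * (η - w t * conj η))
      = (I * η' - (εa t + εm t * conj η + ε0 t / 2 * η))
        + w t * conj (I * η' - (εa t + εm t * conj η + ε0 t / 2 * η)) := by
    simp only [map_sub, map_add, map_mul, map_div₀, conj_I, conj_conj, hm, h0 t ht, conj_ofNat]
    linear_combination (-conj η) * hweq
  rw [← sub_eq_zero, key, ← sub_eq_zero (a := I * η')]
  constructor
  · exact eq_zero_of_add_mul_conj (hw t ht)
  · intro h; rw [h]; simp

/-- Transports the decoupling from the disk to the half plane. -/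
lemma etaHalfPlane_eq {v : ℂ} (u : ℂ) (hv : 0 < v.im) :
    etaHalfPlane v u = etaDisk (cayleyZ v u) (cayleyW v) := by
  have h := add_I_ne_zero hv
  have hw := norm_cayleyW_lt_one hv
  have h' : conj v - I ≠ 0 := by
    have := (map_ne_zero (starRingEnd ℂ)).2 h
    simpa [sub_eq_add_neg] using this
  have hD := diskDen_ne_zero hw
  have hvv : conj v - v ≠ 0 := by
    intro h0
    have := congrArg im h0
    simp at this
    linarith
  have e : diskDen (cayleyW v) = 2 * I * (conj v - v) / ((v + I) * (conj v - I)) := by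
    simp only [diskDen, cayleyW, map_div₀, map_sub, map_add, conj_I]
    rw [← sub_eq_add_neg, sub_neg_eq_add]
    field_simp
    ring
  rw [etaDisk_eq_meanA, meanA, e, etaHalfPlane]
  simp only [cayleyZ, cayleyW, map_div₀, map_add, map_mul, conj_I, conj_ofNat]
  rw [← sub_eq_add_neg]
  field_simp
  ring

theorem halfPlaneEq_iff_decoupledHalfPlaneEq {εa ε0 εp εm : ℝ → ℂ} {J : Set ℝ} (hJ : IsOpen J)
    (hpm : ∀ t ∈ J, conj (εp t) = εm t) (h0 : ∀ t ∈ J, conj (ε0 t) = ε0 t) {v u : ℝ → ℂ}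
    (hv : ∀ t ∈ J, 0 < (v t).im) :
    HalfPlaneEq εa ε0 εp εm J v u ↔
      DecoupledHalfPlaneEq εa ε0 εp εm J (fun t => etaHalfPlane (v t) (u t)) v := by
  rw [← diskEq_cayley_iff hJ hv, diskEq_iff_decoupledDiskEq hJ hpm h0
    fun t ht => norm_cayleyW_lt_one (hv t ht)]
  refine forall₂_congr fun t ht => ?_
  have he : (fun t => etaHalfPlane (v t) (u t))
      =ᶠ[𝓝 t] fun t => etaDisk (cayleyZ (v t) (u t)) (cayleyW (v t)) := by
    filter_upwards [hJ.mem_nhds ht] with s hs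
    exact etaHalfPlane_eq _ (hv s hs)
  rw [differentiableAt_cayleyW_iff hJ hv ht, he.differentiableAt_iff, he.deriv_eq]
  beta_reduce
  rw [etaHalfPlane_eq _ (hv t ht)]
  refine and_congr_right fun _ => and_congr_right fun hd => and_congr_right fun _ => ?_
  rw [(hasDerivAt_cayleyW (hv t ht) hd).deriv, cayleyW_eq_iff (hv t ht)]

/-! ## Quantum motion -/

/-- The normalizing factor `e^{iφ} ⟨e_{z,w}, e_{z,w}⟩^{-1/2}`. -/
def phaseFactor (k φ : ℝ) (z w : ℂ) : ℂ :=
  exp (I * φ) / (Real.sqrt (braket (coh k z w) (coh k z w)).re : ℂ)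

/-- The exponential form lets the factor be differentiated through the Kähler potential. -/
lemma phaseFactor_eq (k φ : ℝ) (z : ℂ) {w : ℂ} (hw : ‖w‖ < 1) :
    phaseFactor k φ z w = exp (I * φ - kahlerPot k ![z, w] / 2) := by
  have hpos : 0 < (braket (coh k z w) (coh k z w)).re := by
    rw [braket_coh_eq z hw, ofReal_re]
    have := norm_cohHilb_pos (k := k) z hw
    positivity
  rw [phaseFactor, Complex.exp_sub]
  congr 1
  have e : Real.sqrt (braket (coh k z w) (coh k z w)).re
      = Real.exp (Real.log (braket (coh k z w) (coh k z w)).re / 2) := by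
    rw [Real.exp_half, Real.exp_log hpos]
  rw [e]
  simp [kahlerPot]

lemma phaseFactor_ne_zero (k φ : ℝ) (z : ℂ) {w : ℂ} (hw : ‖w‖ < 1) :
    phaseFactor k φ z w ≠ 0 := by
  rw [phaseFactor_eq k φ z hw]
  exact exp_ne_zero _

section Curve
variable {k : ℝ} {z w : ℝ → ℂ} {t : ℝ} (hw : ‖w t‖ < 1)
  (hdz : DifferentiableAt ℝ z t) (hdw : DifferentiableAt ℝ w t)
include hw hdz hdw

omit hw in
lemma hasDerivAt_curve : HasDerivAt (fun t => ![z t, w t]) ![deriv z t, deriv w t] t := by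
  refine hasDerivAt_pi.2 fun i => ?_
  fin_cases i
  · exact hdz.hasDerivAt
  · exact hdw.hasDerivAt

lemma hasDerivAt_cohHilb_curve : HasDerivAt (fun t => cohHilb k ![z t, w t])
    (deriv z t • cohHilbZ k ![z t, w t] + deriv w t • cohHilbW k ![z t, w t]) t := by
  have hE : HasFDerivAt (cohHilb k) ((formHilb (cohHilbZ k ![z t, w t])
      (cohHilbW k ![z t, w t])).restrictScalars ℝ) ![z t, w t] :=
    (hasFDerivAt_cohHilb k (p := ![z t, w t]) hw).restrictScalars ℝ
  refine (HasFDerivAt.comp_hasDerivAt (f := fun t => ![z t, w t]) t hE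
    (hasDerivAt_curve hdz hdw)).congr_deriv ?_
  rw [ContinuousLinearMap.coe_restrictScalars', formHilb_apply]
  rfl

lemma hasDerivAt_kahlerPot_curve (hk : 1 / 4 < k) :
    HasDerivAt (fun t => kahlerPot k ![z t, w t])
      ((conj (meanA (z t) (w t)) * deriv z t + conj (meanKm k (z t) (w t)) * deriv w t)
        + conj (conj (meanA (z t) (w t)) * deriv z t
          + conj (meanKm k (z t) (w t)) * deriv w t)) t := by
  refine (HasFDerivAt.comp_hasDerivAt (f := fun t => ![z t, w t]) t (hasWirt_kahlerPot hk (p := ![z t, w t]) hw)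
    (hasDerivAt_curve hdz hdw)).congr_deriv ?_
  simp
  ring

end Curve

lemma exists_hasDerivAt_of_continuousOn {J : Set ℝ} (hJ : IsOpen J) (hJc : J.OrdConnected)
    {g : ℝ → ℝ} (hg : ContinuousOn g J) : ∃ φ : ℝ → ℝ, ∀ t ∈ J, HasDerivAt φ (g t) t := by
  rcases J.eq_empty_or_nonempty with rfl | ⟨a, ha⟩
  · exact ⟨0, by simp⟩
  · refine ⟨fun t => ∫ s in a..t, g s, fun t ht => ?_⟩
    exact intervalIntegral.integral_hasDerivAt_right
      ((hg.mono (hJc.uIcc_subset ha ht)).intervalIntegrable)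
      (hg.stronglyMeasurableAtFilter hJ t ht) (hg.continuousAt (hJ.mem_nhds ht))

lemma opAd_zero_left (f : Coeff) (m : ℕ) : opAd f (0, m) = 0 := by simp [opAd]

lemma opAd_one_left (f : Coeff) (m : ℕ) : opAd f (1, m) = f (0, m) := by simp [opAd]

lemma opKp_zero_zero (k : ℝ) (f : Coeff) : opKp k f (0, 0) = 0 := by
  simp [opKp_apply, opAd_zero_left, opKp']

lemma opKp_one_zero (k : ℝ) (f : Coeff) : opKp k f (1, 0) = 0 := by
  simp [opKp_apply, opAd_zero_left, opAd_one_left, opKp']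

lemma opKp_zero_one (k : ℝ) (f : Coeff) :
    opKp k f (0, 1) = Real.sqrt (2 * (k - 1 / 4)) * f (0, 0) := by
  simp [opKp_apply, opAd_zero_left, opKp']

lemma coh_one_zero (k : ℝ) (z w : ℂ) : coh k z w (1, 0) = z := by
  simp [coh_eq_cohCoeff, cohCoeff, hermiteTwo, suRadial]

lemma coh_zero_one (k : ℝ) (z w : ℂ) :
    coh k z w (0, 1) = Real.sqrt (2 * (k - 1 / 4)) * w := by
  simp [coh_eq_cohCoeff, cohCoeff, hermiteTwo, suRadial]

lemma hasDerivAt_coeff {ψ : ℝ → Hilb} {t : ℝ} (h : DifferentiableAt ℝ ψ t) (q : ℕ × ℕ) :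
    HasDerivAt (fun t => (ψ t : Coeff) q) (((deriv ψ t : Hilb) : Coeff) q) t :=
  (lp.evalCLM ℝ (fun _ : ℕ × ℕ => ℂ) 2 q).hasFDerivAt.comp_hasDerivAt t h.hasDerivAt

/-- If `a` and `a y` satisfy `i ȧ = a c` and `i (a y)˙ = a (c y + A)` then `i ẏ = A`. -/
lemma differentiableAt_of_mul {a b y : ℝ → ℂ} {a' b' c A : ℂ} {s : ℝ} (ha : HasDerivAt a a' s)
    (hb : HasDerivAt b b' s) (h0 : a s ≠ 0) (hy : y =ᶠ[𝓝 s] fun s => b s / a s)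
    (hA : I * a' = a s * c) (hB : I * b' = a s * (c * y s + A)) :
    DifferentiableAt ℝ y s ∧ I * deriv y s = A := by
  have h := (hb.div ha h0).congr_of_eventuallyEq hy
  refine ⟨h.differentiableAt, ?_⟩
  have e : b s = y s * a s := by rw [hy.eq_of_nhds, div_mul_cancel₀ _ h0]
  rw [h.deriv, e, ← mul_div_assoc, div_eq_iff (pow_ne_zero 2 h0)]
  linear_combination a s * hB - y s * a s * hA

theorem quantumMotion_iff {k : ℝ} (hk : 1 / 4 < k) {J : Set ℝ} (hJ : IsOpen J)
    (hJc : J.OrdConnected) {ca cd c0 cp cm : ℝ → ℂ} (hca : ContinuousOn ca J)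
    (hc0 : ContinuousOn c0 J) (hcm : ContinuousOn cm J) (ha : ∀ t ∈ J, conj (ca t) = cd t)
    (h0 : ∀ t ∈ J, conj (c0 t) = c0 t) (hm : ∀ t ∈ J, conj (cm t) = cp t) {z w : ℝ → ℂ}
    (hw : ∀ t ∈ J, ‖w t‖ < 1) :
    QuantumMotion k (fun t => linHam k (ca t) (cd t) (c0 t) (cp t) (cm t)) J z w ↔
      ∀ t ∈ J, DifferentiableAt ℝ z t ∧ DifferentiableAt ℝ w t ∧
        I * deriv z t = fieldZ (ca t) (cd t) (c0 t) (cm t) (z t) (w t) ∧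
        I * deriv w t = fieldW (c0 t) (cp t) (cm t) (w t) := by
  constructor
  · rintro ⟨φ, ψ, h⟩ t ht
    have hval : ∀ s ∈ J, (ψ s : Coeff) = phaseFactor k (φ s) (z s) (w s) • coh k (z s) (w s) :=
      fun s hs => (h s hs).2.1
    obtain ⟨-, -, hdψ, hS⟩ := h t ht
    have hS' : ∀ q, I * ((deriv ψ t : Hilb) : Coeff) q = phaseFactor k (φ t) (z t) (w t) *
        (fieldOne k (ca t) (c0 t) (cm t) (z t) (w t) * coh k (z t) (w t) q
          + fieldZ (ca t) (cd t) (c0 t) (cm t) (z t) (w t) * opAd (coh k (z t) (w t)) q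
          + fieldW (c0 t) (cp t) (cm t) (w t) * opKp k (coh k (z t) (w t)) q) := fun q => by
      have := congrFun hS q
      rwa [hval t ht, map_smul, linHam_coh hk] at this
    -- The coefficients of `ψ = c e` at `(0,0)`, `(1,0)`, `(0,1)` are `c`, `c z` and `c √(2k') w`.
    -- At these places `a† e` is `0, 1, 0` and `K_+ e` is `0, 0, √(2k')`, so quotients isolate `z`
    -- and `w` and also give their differentiability.
    have hκ : (Real.sqrt (2 * (k - 1 / 4)) : ℂ) ≠ 0 := by
      exact_mod_cast (Real.sqrt_pos.2 (by linarith : 0 < 2 * (k - 1 / 4))).ne'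
    have hne : ∀ s ∈ J, (ψ s : Coeff) (0, 0) ≠ 0 := fun s hs => by
      rw [hval s hs, Pi.smul_apply, coh_zero_zero, smul_eq_mul, mul_one]
      exact phaseFactor_ne_zero k _ _ (hw s hs)
    have h00 : (ψ t : Coeff) (0, 0) = phaseFactor k (φ t) (z t) (w t) := by
      rw [hval t ht, Pi.smul_apply, coh_zero_zero, smul_eq_mul, mul_one]
    have hA : I * ((deriv ψ t : Hilb) : Coeff) (0, 0)
        = (ψ t : Coeff) (0, 0) * fieldOne k (ca t) (c0 t) (cm t) (z t) (w t) := by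
      rw [hS', h00, coh_zero_zero, opAd_zero_left, opKp_zero_zero]
      ring
    have hz := differentiableAt_of_mul (y := z) (hasDerivAt_coeff hdψ (0, 0))
      (hasDerivAt_coeff hdψ (1, 0)) (hne t ht)
      (by
        filter_upwards [hJ.mem_nhds ht] with s hs
        rw [eq_div_iff (hne s hs), hval s hs, Pi.smul_apply, Pi.smul_apply, coh_zero_zero,
          coh_one_zero, smul_eq_mul, smul_eq_mul]
        ring) hA
      (A := fieldZ (ca t) (cd t) (c0 t) (cm t) (z t) (w t))
      (by rw [hS', h00, coh_one_zero, opAd_one_left, opKp_one_zero, coh_zero_zero]; ring)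
    have hw' := differentiableAt_of_mul (y := w) (hasDerivAt_coeff hdψ (0, 0))
      ((hasDerivAt_coeff hdψ (0, 1)).div_const (Real.sqrt (2 * (k - 1 / 4)) : ℂ)) (hne t ht)
      (by
        filter_upwards [hJ.mem_nhds ht] with s hs
        rw [eq_div_iff (hne s hs), hval s hs, Pi.smul_apply, Pi.smul_apply, coh_zero_zero,
          coh_zero_one, smul_eq_mul, smul_eq_mul, eq_div_iff hκ]
        ring) hA
      (A := fieldW (c0 t) (cp t) (cm t) (w t))
      (by
        rw [← mul_div_assoc, hS', h00, coh_zero_one, opAd_zero_left, opKp_zero_one, coh_zero_zero,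
          div_eq_iff hκ]
        ring)
    exact ⟨hz.1, hw'.1, hz.2, hw'.2⟩
  · intro h
    have hzc : ContinuousOn z J := fun t ht => (h t ht).1.continuousAt.continuousWithinAt
    have hwc : ContinuousOn w J := fun t ht => (h t ht).2.1.continuousAt.continuousWithinAt
    -- The phase must satisfy `φ̇ = -Re P`, where `P` is the multiplication term of the Hamiltonian.
    have hone : ContinuousOn (fun t => -(fieldOne k (ca t) (c0 t) (cm t) (z t) (w t)).re) J := by
      unfold fieldOne
      fun_prop
    obtain ⟨φ, hφ⟩ := exists_hasDerivAt_of_continuousOn hJ hJc hone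
    refine ⟨φ, fun t => phaseFactor k (φ t) (z t) (w t) • cohHilb k ![z t, w t], fun t ht => ?_⟩
    obtain ⟨hdz, hdw, hz', hw'⟩ := h t ht
    have hE := hasDerivAt_cohHilb_curve (k := k) (hw t ht) hdz hdw
    have hK := hasDerivAt_kahlerPot_curve (hw t ht) hdz hdw hk
    set o := fieldOne k (ca t) (c0 t) (cm t) (z t) (w t) with ho
    set X := conj (meanA (z t) (w t)) * deriv z t + conj (meanKm k (z t) (w t)) * deriv w t with hX
    have hc : HasDerivAt (fun t => phaseFactor k (φ t) (z t) (w t))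
        (phaseFactor k (φ t) (z t) (w t) * (I * (-o.re : ℝ) - (X + conj X) / 2)) t := by
      have h1 := ((((hφ t ht).ofReal_comp).const_mul I).sub (hK.div_const 2)).cexp
      rw [phaseFactor_eq k _ _ (hw t ht)]
      refine h1.congr_of_eventuallyEq ?_
      filter_upwards [hJ.mem_nhds ht] with s hs
      exact phaseFactor_eq k _ _ (hw s hs)
    have hψ : HasDerivAt (fun t => phaseFactor k (φ t) (z t) (w t) • cohHilb k ![z t, w t]) _ t :=
      hc.smul hE
    have hcoe : (cohHilb k ![z t, w t] : Coeff) = coh k (z t) (w t) :=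
      coe_cohHilb (p := ![z t, w t]) (hw t ht)
    have hcoeZ : (cohHilbZ k ![z t, w t] : Coeff) = opAd (coh k (z t) (w t)) :=
      coe_cohHilbZ (p := ![z t, w t]) (hw t ht)
    have hcoeW : (cohHilbW k ![z t, w t] : Coeff) = opKp k (coh k (z t) (w t)) :=
      coe_cohHilbW (p := ![z t, w t]) (hw t ht)
    have hval : ((phaseFactor k (φ t) (z t) (w t) • cohHilb k ![z t, w t] : Hilb) : Coeff)
        = phaseFactor k (φ t) (z t) (w t) • coh k (z t) (w t) := by
      rw [lp.coeFn_smul, hcoe]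
    refine ⟨(hφ t ht).differentiableAt, hval, hψ.differentiableAt, ?_⟩
    have hIX : I * X = symbForm k (ca t) (cd t) (c0 t) (cp t) (cm t) (z t) (w t) - o := by
      rw [symbForm, ← hz', ← hw', hX]
      ring
    have hreal := conj_symbForm k (ca t) (cd t) (c0 t) (cp t) (cm t) (z t) (hw t ht)
    rw [ha t ht, h0 t ht, hm t ht, ← ha t ht, conj_conj, ha t ht, ← hm t ht, conj_conj, hm t ht]
      at hreal
    have hIX' := congrArg conj hIX
    rw [map_mul, conj_I, map_sub, hreal] at hIX'
    -- This is `iċ = P c`. The phase supplies `Re P`; the normalization supplies `i Im P`, because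
    -- `i X` and `-i X̄` equal the same real symbol minus `P` and `P̄` respectively.
    have hI : I * (I * (-o.re : ℝ) - (X + conj X) / 2) = o := by
      rw [ofReal_neg, re_eq_add_conj]
      linear_combination (-1 / 2) * hIX + (1 / 2) * hIX' - (o + conj o) / 2 * I_mul_I
    refine (congrArg (fun x : Hilb => I • (x : Coeff)) hψ.deriv).trans (Eq.trans ?_
      (congrArg (linHam k (ca t) (cd t) (c0 t) (cp t) (cm t)) hval.symm))
    simp only [lp.coeFn_add, lp.coeFn_smul, hcoe, hcoeZ, hcoeW]
    rw [map_smul, linHam_coh hk, ← ho, ← hz', ← hw']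
    generalize I * ((-o.re : ℝ) : ℂ) - (X + conj X) / 2 = y at hI ⊢
    rw [← hI]
    module

end

end SiegelJacobi

/-! ### The equations of motion and their decoupling -/

theorem proposition4p2 (k : ℝ) (hk : ∃ n : ℕ, 2 ≤ n ∧ 2 * k = n)
    (J : Set ℝ) (hJ : IsOpen J) (hJc : J.OrdConnected)
    (εa ε0 εp εm : ℝ → ℂ)
    (hca : ContinuousOn εa J) (hc0 : ContinuousOn ε0 J) (hcp : ContinuousOn εp J)
    (hpm : ∀ t ∈ J, conj (εp t) = εm t) (h0 : ∀ t ∈ J, conj (ε0 t) = ε0 t) :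
    -- the coherent state vectors lie in the Hilbert space and in the domain of the Hamiltonians
    (∀ z w : ℂ, ‖w‖ < 1 → Memℓp (coh k z w) 2 ∧
      ∀ ca cd c0 cp cm : ℂ, Memℓp (linHam k ca cd c0 cp cm (coh k z w)) 2) ∧
    -- equations of motion on the Siegel-Jacobi disk
    (∀ z w : ℝ → ℂ, (∀ t ∈ J, ‖w t‖ < 1) →
      List.TFAE
        [ClassicalMotion k
          (fun t p => symb (linHam k (conj (εa t)) (εa t) (ε0 t) (εm t) (εp t))
            (coh k (p 0) (p 1))) J z w,
         QuantumMotion k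
          (fun t => linHam k (conj (εa t)) (εa t) (ε0 t) (εm t) (εp t)) J z w,
         ClassicalMotion k
          (fun t p => symb (linHam k (εa t) (conj (εa t)) (ε0 t) (εp t) (εm t))
            (coh k (conj (p 0)) (conj (p 1)))) J z w,
         DiskEq εa ε0 εp εm J z w]) ∧
    -- the partial Cayley transform to the Siegel-Jacobi upper half plane
    (∀ v u : ℝ → ℂ, (∀ t ∈ J, 0 < (v t).im) →
      (DiskEq εa ε0 εp εm J (fun t => cayleyZ (v t) (u t)) (fun t => cayleyW (v t)) ↔
        HalfPlaneEq εa ε0 εp εm J v u)) ∧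
    -- decoupling on the Siegel-Jacobi disk
    (∀ z w : ℝ → ℂ, (∀ t ∈ J, ‖w t‖ < 1) →
      (DiskEq εa ε0 εp εm J z w ↔
        DecoupledDiskEq εa ε0 εp εm J (fun t => etaDisk (z t) (w t)) w)) ∧
    -- decoupling on the Siegel-Jacobi upper half plane
    (∀ v u : ℝ → ℂ, (∀ t ∈ J, 0 < (v t).im) →
      (HalfPlaneEq εa ε0 εp εm J v u ↔
        DecoupledHalfPlaneEq εa ε0 εp εm J (fun t => etaHalfPlane (v t) (u t)) v)) := by
  have hk4 : 1 / 4 < k := by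
    obtain ⟨n, hn, h⟩ := hk
    have : (2 : ℝ) ≤ n := by exact_mod_cast hn
    linarith
  refine ⟨fun z w hw => ⟨memℓp_of_geomDecay (coh_mem_geomDecay k z hw), fun ca cd c0 cp cm =>
    memℓp_of_geomDecay (linHam_coh_mem_geomDecay hk4 ca cd c0 cp cm z hw)⟩, fun z w hw => ?_,
    fun v u hv => diskEq_cayley_iff hJ hv,
    fun z w hw => diskEq_iff_decoupledDiskEq hJ hpm h0 hw,
    fun v u hv => halfPlaneEq_iff_decoupledHalfPlaneEq hJ hpm h0 hv⟩
  have hfield : DiskEq εa ε0 εp εm J z w ↔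
      ∀ t ∈ J, DifferentiableAt ℝ z t ∧ DifferentiableAt ℝ w t ∧
        I * deriv z t = fieldZ (conj (εa t)) (εa t) (ε0 t) (εp t) (z t) (w t) ∧
        I * deriv w t = fieldW (ε0 t) (εm t) (εp t) (w t) := Iff.rfl
  have ha := classicalMotion_iff hk4 (ca := fun t => conj (εa t)) (cd := εa) (c0 := ε0) (cp := εm)
    (cm := εp) (z := z) hw (E := fun t p => symb (linHam k (conj (εa t)) (εa t) (ε0 t) (εm t) (εp t))
      (coh k (p 0) (p 1))) fun t p hp => symb_linHam hk4 _ hp _ _ _ _ _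
  -- The symbol of `H` at the conjugate point is the symbol of `H̃` at the point itself, so the same
  -- vector field arises as for (a).
  have hc := classicalMotion_iff hk4 (ca := fun t => conj (εa t)) (cd := εa) (c0 := ε0) (cp := εm)
    (cm := εp) (z := z) hw (E := fun t p => symb (linHam k (εa t) (conj (εa t)) (ε0 t) (εp t) (εm t))
      (coh k (conj (p 0)) (conj (p 1)))) fun t p hp => by
        rw [symb_linHam hk4 _ (by rwa [norm_conj]), symbForm_conj _ _ _ _ _ _ _ hp]
  have hb := quantumMotion_iff hk4 hJ hJc (ca := fun t => conj (εa t)) (cd := εa) (c0 := ε0)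
    (cp := εm) (cm := εp) (continuous_conj.comp_continuousOn hca) hc0 hcp
    (fun t _ => conj_conj _) h0 hpm (z := z) hw
  tfae_have 1 ↔ 4 := ha.trans hfield.symm
  tfae_have 2 ↔ 4 := hb.trans hfield.symm
  tfae_have 3 ↔ 4 := hc.trans hfield.symm
  tfae_finish
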